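/- Let $A\to M$ be a Lie algebroid of rank $n$ over a smooth manifold $M$, with anchor $a$. Write $\Gamma(\wedge^kA)$ and $\Gamma(\wedge^kA^*)$ for the smooth sections of the exterior powers of $A$ and $A^*$. The Lie algebroid differential $d:\Gamma(\wedge^kA^*)\to\Gamma(\wedge^{k+1}A^*)$ is given by $$(d\omega)(X_1,\dots,X_{k+1})=\sum_{i}(-1)^{i+1}a(X_i)\bigl(\omega(X_1,\dots,\widehat{X_i},\dots,X_{k+1})\bigr)+\sum_{i<j}(-1)^{i+j}\omega([X_i,X_j],X_1,\dots,\widehat{X_i},\dots,\widehat{X_j},\dots,X_{k+1}),$$ and $H^k(A,\mathbb R)$ is the space of closed forms modulo the exact ones. For a form $\theta$ and a multivector $V$ of degrees $l\le k$, the contraction $\theta\lrcorner V\in\Gamma(\wedge^{k-l}A)$ is defined by $\langle\omega,\theta\lrcorner V\rangle=\langle\theta\wedge\omega,V\rangle$ for all $\omega$ of degree $k-l$. An $A$-connection on $\wedge^nA$ is an $\mathbb R$-bilinear map $\nabla:\Gamma(A)\times\Gamma(\wedge^nA)\to\Gamma(\wedge^nA)$ with $\nabla_{fX}s=f\nabla_Xs$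 and $\nabla_X(fs)=(a(X)f)s+f\nabla_Xs$ for $f\in C^\infty(M)$. Its generating operator $D:\Gamma(\wedge^kA)\to\Gamma(\wedge^{k-1}A)$ is given as follows: if $U=\omega\lrcorner\Lambda'$ near a point $x$, with $\omega\in\Gamma(\wedge^{n-k}A^*)$ and $\Lambda'\in\Gamma(\wedge^nA)$ nonzero at $x$, then $$DU|_x=-(-1)^{|\omega|}\Bigl(d\omega\lrcorner\Lambda'+\sum_{i=1}^n(\alpha_i\wedge\omega)\lrcorner\nabla_{X_i}\Lambda'\Bigr)\Big|_x,$$ where $X_1,\dots,X_n$ is a basis of the fibre of $A$ at $x$ and $\alpha_1,\dots,\alpha_n$ is the dual basis. Put $\partial=(-1)^{n-k}D$ on $\Gamma(\wedge^kA)$ and $H_k(A,\nabla)=\ker\partial/\operatorname{im}\partial$. **Theorem.** Let $\nabla_0$ be an $A$-connection on $\wedge^nA$ for which there is a nowhere vanishing section $\Lambda\in\Gamma(\wedge^nA)$ that is horizontal, i.e. $(\nabla_0)_X\Lambda=0$ for all $X\in\Gamma(A)$. Then the conditions above determine unique linear operators $d$ and $D_0$ (the latter for $\nabla_0$). The map $*:\Gamma(\wedge^{q}A^*)\to\Gamma(\wedge^{n-q}A)$,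 $*\omega=\omega\lrcorner\Lambda$, is a linear isomorphism for every $0\le q\le n$. The operator $\partial_0=(-1)^{n-k}D_0$ on $\Gamma(\wedge^kA)$ satisfies $$\partial_0=-*\circ d\circ *^{-1}$$ for $1\le k\le n$. For every $0\le k\le n$, the map $*$ sends closed forms to cycles and induces an isomorphism $$H^{n-k}(A,\mathbb R)\;\cong\;H_k(A,\nabla_0).$$ -/

import Mathlib

open Bundle
open scoped Manifold ContDiff Topology

noncomputable section

namespace LieAlgebroidHomology

/-! ### Linear algebra in one fibre -/

section Fibre

variable {W : Type*} [AddCommGroup W] [Module ℝ W]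

/-- The wedge product of alternating forms,
`(θ ∧ ξ)(v₁, …, v_{p+q}) = ∑ sign σ · θ(v_{σ1}, …, v_{σp}) · ξ(v_{σ(p+1)}, …, v_{σ(p+q)})`,
the sum being over the `(p, q)`-shuffles `σ`. -/
def wedge {p q : ℕ} (θ : W [⋀^Fin p]→ₗ[ℝ] ℝ) (ξ : W [⋀^Fin q]→ₗ[ℝ] ℝ) :
    W [⋀^Fin (p + q)]→ₗ[ℝ] ℝ :=
  ((LinearMap.mul' ℝ ℝ).compAlternatingMap (θ.domCoprod ξ)).domDomCongr finSumFinEquiv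

/-- The pairing `⟨θ, U⟩` of an alternating `k`-form with a `k`-vector, normalised by
`⟨θ, v₁ ∧ ⋯ ∧ v_k⟩ = θ(v₁, …, v_k)`. -/
def pairing {k : ℕ} (θ : W [⋀^Fin k]→ₗ[ℝ] ℝ) : ⋀[ℝ]^k W →ₗ[ℝ] ℝ :=
  exteriorPower.alternatingMapLinearEquiv θ

/-- The contraction `θ ⌟ U` of an `l`-form `θ` with an `n`-vector `U`, where `l + k = n`.  It is
the `k`-vector given on decomposable `U` by
`θ ⌟ (v₁ ∧ ⋯ ∧ vₙ) = ∑ sign σ · θ(v_{σ1}, …, v_{σl}) · v_{σ(l+1)} ∧ ⋯ ∧ v_{σn}`,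
the sum being over the `(l, k)`-shuffles `σ`; it is characterised by
`⟨ξ, θ ⌟ U⟩ = ⟨θ ∧ ξ, U⟩` for all `k`-forms `ξ` (see `pairing_contract`). -/
def contract {l k n : ℕ} (h : l + k = n) (θ : W [⋀^Fin l]→ₗ[ℝ] ℝ) :
    ⋀[ℝ]^n W →ₗ[ℝ] ⋀[ℝ]^k W :=
  exteriorPower.alternatingMapLinearEquiv
    (((TensorProduct.lid ℝ (⋀[ℝ]^k W)).toLinearMap.compAlternatingMap
      (θ.domCoprod (exteriorPower.ιMulti ℝ k))).domDomCongr
        (finSumFinEquiv.trans (finCongr h)))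

theorem pairing_contract {l k : ℕ} (θ : W [⋀^Fin l]→ₗ[ℝ] ℝ) (ξ : W [⋀^Fin k]→ₗ[ℝ] ℝ)
    (U : ⋀[ℝ]^(l + k) W) :
    pairing ξ (contract rfl θ U) = pairing (wedge θ ξ) U := by
  suffices h : pairing ξ ∘ₗ contract rfl θ = pairing (wedge θ ξ) from LinearMap.congr_fun h U
  refine exteriorPower.linearMap_ext (AlternatingMap.ext fun v => ?_)
  simp only [contract, pairing, wedge, LinearMap.compAlternatingMap_apply, LinearMap.comp_apply,
    exteriorPower.alternatingMapLinearEquiv_apply_ιMulti, AlternatingMap.domDomCongr_apply,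
    AlternatingMap.domCoprod_apply, sum_apply, map_sum]
  refine Finset.sum_congr rfl fun σ _ => ?_
  induction σ using Quotient.inductionOn' with | _ σ
  rw [AlternatingMap.domCoprod.summand_mk'', AlternatingMap.domCoprod.summand_mk'']
  rcases Int.units_eq_one_or (Equiv.Perm.sign σ) with hσ | hσ <;>
    simp [hσ, MultilinearMap.domDomCongr_apply, MultilinearMap.domCoprod_apply]

end Fibre

/-! ### Sections, forms and multivector fields -/

section Bundles

variable {E : Type*} [NormedAddCommGroup E] [NormedSpace ℝ E]
  {H : Type*} [TopologicalSpace H] (I : ModelWithCorners ℝ E H)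
  {M : Type*} [TopologicalSpace M] [ChartedSpace H M]
  (F : Type*) [NormedAddCommGroup F] [NormedSpace ℝ F]
  (V : M → Type*) [TopologicalSpace (TotalSpace F V)]
  [∀ x, AddCommGroup (V x)] [∀ x, Module ℝ (V x)] [∀ x, TopologicalSpace (V x)]
  [FiberBundle F V] [VectorBundle ℝ F V]

/-- `Γ(A)`: smooth sections of the vector bundle `A` with fibres `V x` and model fibre `F`. -/
abbrev Sec : Type _ := Cₛ^∞⟮I; F, V⟯

/-- `Γ(∧ᵏA*)`: smooth sections of the bundle of alternating `k`-forms on the fibres of `A`. -/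
abbrev Form (k : ℕ) : Type _ :=
  Cₛ^∞⟮I; F [⋀^Fin k]→L[ℝ] ℝ, fun x : M => V x [⋀^Fin k]→L[ℝ] Trivial M ℝ x⟯

/-- Smoothness of a section `U` of `∧ᵏA`: in the local trivialisations of `∧ᵏA` induced by those
of `A`, all coordinates of `U` are smooth functions. -/
def IsSmoothMultivector (k : ℕ) (U : ∀ x, ⋀[ℝ]^k (V x)) : Prop :=
  ∀ (x₀ : M) (φ : F [⋀^Fin k]→ₗ[ℝ] ℝ),
    ContMDiffAt I 𝓘(ℝ, ℝ) ∞
      (fun x => pairing φ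
        (exteriorPower.map k ((trivializationAt F V x₀).linearMapAt ℝ x) (U x))) x₀

/-- `Γ(∧ᵏA)`: smooth sections of the `k`-th exterior power of `A`. -/
def Multivector (k : ℕ) : Submodule ℝ (∀ x, ⋀[ℝ]^k (V x)) where
  carrier := {U | IsSmoothMultivector I F V k U}
  add_mem' := by
    intro U W hU hW x₀ φ
    refine ((hU x₀ φ).add (hW x₀ φ)).congr_of_eventuallyEq (.of_forall fun x => ?_)
    simp
  zero_mem' := by
    intro x₀ φ
    simpa using contMDiffAt_const
  smul_mem' := by
    intro c U hU x₀ φ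
    refine ((contMDiffAt_const (c := c)).mul (hU x₀ φ)).congr_of_eventuallyEq
      (.of_forall fun x => ?_)
    simp

instance (k : ℕ) : AddCommGroup (Multivector I F V k) :=
  Submodule.addCommGroup (M := ∀ x, ⋀[ℝ]^k (V x)) (Multivector I F V k)

variable {I F V}

/-- The product of a smooth function and a smooth section of `A`. -/
def Sec.fsmul (f : C^∞⟮I, M; ℝ⟯) (X : Sec I F V) : Sec I F V :=
  ⟨fun x => f x • X x, f.contMDiff.smul_section X.contMDiff⟩

/-- The product of a smooth function and a smooth section of `∧ᵏA`. -/
def Multivector.fsmul {k : ℕ} (f : C^∞⟮I, M; ℝ⟯) (U : Multivector I F V k) :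
    Multivector I F V k :=
  ⟨fun x => f x • U.1 x, by
    intro x₀ φ
    refine ((f.contMDiff x₀).mul (U.2 x₀ φ)).congr_of_eventuallyEq (.of_forall fun x => ?_)
    simp⟩

/-- The alternating form on the fibre at `x` given by a `k`-form. -/
def Form.at {k : ℕ} (η : Form I F V k) (x : M) : V x [⋀^Fin k]→ₗ[ℝ] ℝ :=
  (η x : V x [⋀^Fin k]→L[ℝ] ℝ).toAlternatingMap

end Bundles

section Algebroids

variable {E : Type*} [NormedAddCommGroup E] [NormedSpace ℝ E]
  {H : Type*} [TopologicalSpace H] (I : ModelWithCorners ℝ E H)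
  {M : Type*} [TopologicalSpace M] [ChartedSpace H M] [IsManifold I ∞ M]
  (F : Type*) [NormedAddCommGroup F] [NormedSpace ℝ F]
  (V : M → Type*) [TopologicalSpace (TotalSpace F V)]
  [∀ x, AddCommGroup (V x)] [∀ x, Module ℝ (V x)] [∀ x, TopologicalSpace (V x)]
  [FiberBundle F V] [VectorBundle ℝ F V]

variable {I} in
/-- The derivative `df_x(v)` of a real function at `x` along the tangent vector `v`. -/
def dirDeriv (f : M → ℝ) (x : M) (v : TangentSpace I x) : ℝ :=
  mfderiv I 𝓘(ℝ, ℝ) f x v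

/-- A Lie algebroid structure on the vector bundle `A`: a real Lie algebra structure on `Γ(A)`
and a smooth bundle map `anchor : A → TM` over the identity, compatible with the brackets and
satisfying the Leibniz rule. -/
structure LieAlgebroid where
  bracket : Sec I F V →ₗ[ℝ] Sec I F V →ₗ[ℝ] Sec I F V
  bracket_self : ∀ X, bracket X X = 0
  jacobi : ∀ X Y Z,
    bracket X (bracket Y Z) + bracket Y (bracket Z X) + bracket Z (bracket X Y) = 0
  anchor : ∀ x, V x →ₗ[ℝ] TangentSpace I x
  contMDiff_anchor : ContMDiff (I.prod 𝓘(ℝ, F)) I.tangent ∞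
    (fun p : TotalSpace F V => (⟨p.1, anchor p.1 p.2⟩ : TangentBundle I M))
  anchor_bracket : ∀ X Y x, anchor x (bracket X Y x) =
    VectorField.mlieBracket I (fun y => anchor y (X y)) (fun y => anchor y (Y y)) x
  leibniz : ∀ (X : Sec I F V) (f : C^∞⟮I, M; ℝ⟯) (Y : Sec I F V) (x : M),
    bracket X (Y.fsmul f) x =
      f x • bracket X Y x + dirDeriv f x (anchor x (X x)) • Y x

variable {I F V}

namespace LieAlgebroid

variable (𝒜 : LieAlgebroid I F V)

/-- The derivative `(a(X) f)(x)` of a function along the anchor of a section. -/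
def deriv (X : Sec I F V) (f : M → ℝ) (x : M) : ℝ :=
  dirDeriv f x (𝒜.anchor x (X x))

/-- The sum `∑_{i<j} (-1)^{i+j} η([X_i, X_j], X_0, …, X̂_i, …, X̂_j, …, X_k)` at the point `x`.
The pairs `i < j` in `{0, …, k}` are written as `i` and `j = j' + 1` with `i ≤ j'`; then
`l ↦ i.succAbove (j'.succAbove l)` is the increasing enumeration of the indices other than
`i` and `j`. -/
def bracketSum : ∀ {k : ℕ}, Form I F V k → (Fin (k + 1) → Sec I F V) → M → ℝ
  | 0, _, _, _ => 0
  | k + 1, η, X, x =>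
    ∑ i : Fin (k + 2), ∑ j' : Fin (k + 1),
      if i ≤ j'.castSucc then
        (-1 : ℝ) ^ ((i : ℕ) + (j'.succ : ℕ)) *
          η.at x (Fin.cons (𝒜.bracket (X i) (X j'.succ) x)
            (fun l : Fin k => X (i.succAbove (j'.succAbove l)) x))
      else 0

/-- `d` is the Lie algebroid differential on `k`-forms: for all sections `X_0, …, X_k` of `A`,
`(dη)(X_0, …, X_k) = ∑_i (-1)^i a(X_i)(η(X_0, …, X̂_i, …, X_k))
  + ∑_{i<j} (-1)^{i+j} η([X_i, X_j], X_0, …, X̂_i, …, X̂_j, …, X_k)`. -/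
def IsDifferential (k : ℕ) (d : Form I F V k →ₗ[ℝ] Form I F V (k + 1)) : Prop :=
  ∀ (η : Form I F V k) (X : Fin (k + 1) → Sec I F V) (x : M),
    (d η).at x (fun i => X i x) =
      (∑ i : Fin (k + 1), (-1 : ℝ) ^ (i : ℕ) *
        𝒜.deriv (X i) (fun y => η.at y (fun l : Fin k => X (i.succAbove l) y)) x)
      + 𝒜.bracketSum η X x

open Classical in
/-- The Lie algebroid differential `d : Γ(∧ᵏA*) → Γ(∧ᵏ⁺¹A*)`, the operator described by
`IsDifferential`. -/
def differential (k : ℕ) : Form I F V k →ₗ[ℝ] Form I F V (k + 1) :=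
  if h : ∃ d, 𝒜.IsDifferential k d then h.choose else 0

/-- Closed `k`-forms. -/
def cocycles (k : ℕ) : Submodule ℝ (Form I F V k) := LinearMap.ker (𝒜.differential k)

/-- Exact `k`-forms. -/
def coboundaries : ∀ k : ℕ, Submodule ℝ (Form I F V k)
  | 0 => ⊥
  | k + 1 => LinearMap.range (𝒜.differential k)

/-- The Lie algebroid cohomology `Hᵏ(A, ℝ)`: closed forms modulo exact forms. -/
abbrev Cohomology (k : ℕ) : Type _ :=
  𝒜.cocycles k ⧸ (𝒜.coboundaries k).comap (𝒜.cocycles k).subtype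

/-- An `A`-connection on the line bundle `∧ⁿA`. -/
structure Connection (n : ℕ) where
  toFun : Sec I F V →ₗ[ℝ] Multivector I F V n →ₗ[ℝ] Multivector I F V n
  smul_left : ∀ (f : C^∞⟮I, M; ℝ⟯) (X : Sec I F V) (s : Multivector I F V n),
    toFun (X.fsmul f) s = Multivector.fsmul f (toFun X s)
  leibniz : ∀ (f : C^∞⟮I, M; ℝ⟯) (X : Sec I F V) (s : Multivector I F V n) (x : M),
    (toFun X (Multivector.fsmul f s)).1 x = 𝒜.deriv X f x • s.1 x + f x • (toFun X s).1 x

variable {𝒜}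

/-- `D : Γ(∧ᵏ⁺¹A) → Γ(∧ᵏA)` is the operator associated with the `A`-connection `∇` on `∧ⁿA`:
whenever `U = η ⌟ Λ` near a point `x`, with `η` a form of degree `q = n - (k + 1)` and `Λ` a
section of `∧ⁿA` with `Λ(x) ≠ 0`, one has at `x`
`D U = -(-1)^q (dη ⌟ Λ + ∑_i (α_i ∧ η) ⌟ ∇_{X_i} Λ)`,
where the `X_i` are sections whose values at `x` are a basis of the fibre of `A`, and the `α_i`
are the dual basis. -/
def IsGeneratingOperator {n : ℕ} (nabla : 𝒜.Connection n) (k : ℕ)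
    (D : Multivector I F V (k + 1) →ₗ[ℝ] Multivector I F V k) : Prop :=
  ∀ (q : ℕ) (h : q + (k + 1) = n) (U : Multivector I F V (k + 1)) (η : Form I F V q)
    (Λ : Multivector I F V n) (x : M), Λ.1 x ≠ 0 →
    (∀ᶠ y in 𝓝 x, U.1 y = contract h (η.at y) (Λ.1 y)) →
    ∀ (X : Fin n → Sec I F V) (b : Module.Basis (Fin n) ℝ (V x)), (∀ i, X i x = b i) →
      (D U).1 x = -((-1 : ℝ) ^ q •
        (contract (show q + 1 + k = n by omega) ((𝒜.differential q η).at x) (Λ.1 x)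
          + ∑ i : Fin n, contract (show 1 + q + k = n by omega)
              (wedge (AlternatingMap.ofSubsingleton ℝ (V x) ℝ (0 : Fin 1) (b.coord i)) (η.at x))
              ((nabla.toFun (X i) Λ).1 x)))

open Classical in
/-- The generating operator `D : Γ(∧ᵏ⁺¹A) → Γ(∧ᵏA)` of an `A`-connection on `∧ⁿA`, the operator
described by `IsGeneratingOperator`. -/
def generatingOperator {n : ℕ} (nabla : 𝒜.Connection n) (k : ℕ) :
    Multivector I F V (k + 1) →ₗ[ℝ] Multivector I F V k :=
  if h : ∃ D, IsGeneratingOperator nabla k D then h.choose else 0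

/-- The boundary operator `∂ = (-1)^{n-(k+1)} D : Γ(∧ᵏ⁺¹A) → Γ(∧ᵏA)`. -/
def boundary {n : ℕ} (nabla : 𝒜.Connection n) (k : ℕ) :
    Multivector I F V (k + 1) →ₗ[ℝ] Multivector I F V k :=
  (-1 : ℝ) ^ ((n : ℤ) - ((k : ℤ) + 1)) • generatingOperator nabla k

/-- The kernel of `∂` on `Γ(∧ᵏA)`; in degree `0` everything is a cycle. -/
def cycles {n : ℕ} (nabla : 𝒜.Connection n) : ∀ k : ℕ, Submodule ℝ (Multivector I F V k)
  | 0 => ⊤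
  | k + 1 => LinearMap.ker (boundary nabla k)

/-- The image of `∂` in `Γ(∧ᵏA)`. -/
def boundaries {n : ℕ} (nabla : 𝒜.Connection n) (k : ℕ) : Submodule ℝ (Multivector I F V k) :=
  LinearMap.range (boundary nabla k)

/-- The Lie algebroid homology `H_k(A, ∇) = ker ∂ / im ∂`. -/
abbrev Homology {n : ℕ} (nabla : 𝒜.Connection n) (k : ℕ) : Type _ :=
  cycles nabla k ⧸ (boundaries nabla k).comap (cycles nabla k).subtype

end LieAlgebroid

end Algebroids

end LieAlgebroidHomology

end

open LieAlgebroidHomology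

/-!
The theorem is a Leibniz-rule computation once three things are available: the differential `d`
exists, contraction with `Λ` is invertible on smooth sections, and the generating operator can be
computed in terms of `Λ` alone.

*The differential.* The right-hand side of the Koszul formula is an alternating map on sections of
`A` with values in smooth functions (`koszul`). Its antisymmetry comes for free from writing it as
an alternatisation. It is linear over smooth functions because the Leibniz rules of the anchor and
of the bracket produce terms that cancel (`isTensorial_koszul`). A tensorial alternating map on
sections is a form (`IsTensorial.toForm`): cut-off functions express a section near a point through
a local frame, so the value at a point depends only on the values of the arguments there. Every
vector extends to a global section (`extendSection`), whence uniqueness of `d`.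

*The map `*`.* On an `n`-dimensional space, contraction of forms with a nonzero element of the top
exterior power is injective: if `θ` does not vanish on some `q` basis vectors, there is a form `ξ`
such that `θ ∧ ξ` does not vanish on the whole basis. The dimensions `n.choose q` and
`n.choose (n - q)` agree, so it is an isomorphism (`contractEquiv`). In a local trivialisation `Λ`
is a nonvanishing function times a constant element, so the fibrewise isomorphism and its inverse
preserve smoothness (`starEquiv`).

*The generating operator.* Any section of `∧ⁿA` is `gΛ` with `g` smooth (`exists_eq_fsmul`). If
`U = η ⌟ gΛ` near `x`, then `*⁻¹U = gη` near `x`, and `d(gη) = g dη + dg ∧ η`. Since `Λ` is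
horizontal, `∇_{X_i}(gΛ) = (a(X_i) g)Λ`, and so the connection term
`∑ (α_i ∧ η) ⌟ ∇_{X_i}(gΛ)` is `(dg ∧ η) ⌟ Λ`, the functional `dg` on the fibre having coordinates
`a(X_i) g` in the dual basis. Hence the formula defining `D` evaluates to `-(-1)^q * d *⁻¹ U`,
whatever the choice of `η` and `g` (`isGeneratingOperator_star`). The two signs `(-1)^q` cancel in
`∂`, which gives `∂ = - * d *⁻¹`, and `*` matches cocycles with cycles and coboundaries with
boundaries. At the two ends of the complexes this uses that there are no forms and no multivectors
of degree greater than `n`.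
-/

noncomputable section

namespace LieAlgebroidHomology

set_option linter.unusedSectionVars false

/-! ### Contraction and wedge product on one fibre -/

section FibreAlgebra

variable {W W' : Type*} [AddCommGroup W] [Module ℝ W] [AddCommGroup W'] [Module ℝ W']

theorem wedge_apply {p q : ℕ} (θ : W [⋀^Fin p]→ₗ[ℝ] ℝ) (ξ : W [⋀^Fin q]→ₗ[ℝ] ℝ)
    (v : Fin (p + q) → W) :
    wedge θ ξ v = ∑ σ : Equiv.Perm.ModSumCongr (Fin p) (Fin q), LinearMap.mul' ℝ ℝ
      (AlternatingMap.domCoprod.summand θ ξ σ (v ∘ finSumFinEquiv)) := by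
  simp only [wedge, LinearMap.compAlternatingMap_apply, AlternatingMap.domDomCongr_apply,
    AlternatingMap.domCoprod_apply, sum_apply, map_sum, Function.comp_def]

/-- The contribution of a single shuffle to a wedge product. -/
theorem mul'_domCoprod_summand_mk {p q : ℕ} (θ : W [⋀^Fin p]→ₗ[ℝ] ℝ) (ξ : W [⋀^Fin q]→ₗ[ℝ] ℝ)
    (σ : Equiv.Perm (Fin p ⊕ Fin q)) (v : Fin p ⊕ Fin q → W) :
    LinearMap.mul' ℝ ℝ (AlternatingMap.domCoprod.summand θ ξ (Quotient.mk'' σ) v) =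
      ((Equiv.Perm.sign σ : ℤ) : ℝ) *
        (θ (fun i => v (σ (.inl i))) * ξ (fun i => v (σ (.inr i)))) := by
  rw [AlternatingMap.domCoprod.summand_mk'']
  rcases Int.units_eq_one_or (Equiv.Perm.sign σ) with hσ | hσ <;>
    simp [hσ, MultilinearMap.domDomCongr_apply, MultilinearMap.domCoprod_apply]

/-- Two permutations of `Fin 1 ⊕ ι` define the same shuffle as soon as they agree on the single
element of `Fin 1`. -/
theorem modSumCongr_mk_eq_iff {q : ℕ} (σ τ : Equiv.Perm (Fin 1 ⊕ Fin q)) :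
    (Quotient.mk'' σ : Equiv.Perm.ModSumCongr (Fin 1) (Fin q)) = Quotient.mk'' τ ↔
      σ (.inl 0) = τ (.inl 0) := by
  rw [Quotient.eq'', QuotientGroup.leftRel_apply]
  constructor
  · rintro ⟨⟨a, b⟩, h⟩
    have h' := inv_mul_eq_iff_eq_mul.mp h.symm
    rw [h']
    simp [Subsingleton.elim (a 0) 0]
  · intro h
    apply Equiv.Perm.mem_sumCongrHom_range_of_perm_mapsTo_inl
    rintro _ ⟨i, rfl⟩
    refine ⟨0, ?_⟩
    rw [Subsingleton.elim i 0, Equiv.Perm.mul_apply, ← h]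
    simp

/-- The expansion of `α ∧ η` for a one-form `α`:
`(α ∧ η)(v₀, …, v_q) = ∑ᵢ (-1)ⁱ α(vᵢ) η(v₀, …, v̂ᵢ, …, v_q)`. -/
theorem wedge_ofSubsingleton_apply {q : ℕ} (α : W →ₗ[ℝ] ℝ) (η : W [⋀^Fin q]→ₗ[ℝ] ℝ)
    (v : Fin (q + 1) → W) :
    wedge (AlternatingMap.ofSubsingleton ℝ W ℝ (0 : Fin 1) α) η
        (v ∘ finCongr (Nat.add_comm 1 q)) =
      ∑ i : Fin (q + 1), (-1 : ℝ) ^ (i : ℕ) * (α (v i) * η (fun l => v (i.succAbove l))) := by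
  rw [wedge_apply]
  let e : Fin 1 ⊕ Fin q ≃ Fin (q + 1) := finSumFinEquiv.trans (finCongr (Nat.add_comm 1 q))
  have e0 : e (.inl 0) = 0 := by ext; simp [e]
  have e1 : ∀ j, e (.inr j) = j.succ := fun j => by ext; simp [e]
  have e0' : e.symm 0 = .inl 0 := by rw [← e0, Equiv.symm_apply_apply]
  -- the shuffle that moves `i` to the front
  let ρ : Fin (q + 1) → Equiv.Perm (Fin 1 ⊕ Fin q) := fun i => e.symm.permCongr i.cycleRange.symm
  have hρ0 : ∀ i, e (ρ i (.inl 0)) = i := fun i => by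
    simp only [ρ, Equiv.permCongr_apply, Equiv.symm_symm, e0, Equiv.apply_symm_apply]
    exact Fin.cycleRange_symm_zero i
  have hρ1 : ∀ i j, e (ρ i (.inr j)) = i.succAbove j := fun i j => by
    simp only [ρ, Equiv.permCongr_apply, Equiv.symm_symm, e1, Equiv.apply_symm_apply]
    exact Fin.cycleRange_symm_succ i j
  symm
  refine Fintype.sum_bijective (fun i => (Quotient.mk'' (ρ i) :
    Equiv.Perm.ModSumCongr (Fin 1) (Fin q))) ⟨fun i j h => ?_, fun σ => ?_⟩ _ _ fun i => ?_
  · rw [← hρ0 i, ← hρ0 j, (modSumCongr_mk_eq_iff _ _).1 h]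
  · induction σ using Quotient.inductionOn' with | _ σ
    refine ⟨e (σ (.inl 0)), (modSumCongr_mk_eq_iff _ _).2 (e.injective ?_)⟩
    rw [hρ0]
  · rw [mul'_domCoprod_summand_mk]
    have hs : Equiv.Perm.sign (ρ i) = (-1) ^ (i : ℕ) := by
      simp [ρ, Equiv.Perm.sign_permCongr, Fin.sign_cycleRange]
    have hv : ∀ s, (((v ∘ finCongr (Nat.add_comm 1 q)) ∘ finSumFinEquiv) s) = v (e s) :=
      fun s => rfl
    simp only [hs, hv, hρ1, AlternatingMap.ofSubsingleton_apply_apply, Fin.isValue, hρ0]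
    simp

theorem contract_domDomCongr {l l' k n : ℕ} (h : l + k = n) (e : l' = l)
    (θ : W [⋀^Fin l']→ₗ[ℝ] ℝ) (U : ⋀[ℝ]^n W) :
    contract h (θ.domDomCongr (finCongr e)) U = contract (e ▸ h : l' + k = n) θ U := by
  subst e
  rfl

theorem pairing_map {k : ℕ} (T : W →ₗ[ℝ] W') (ξ : W' [⋀^Fin k]→ₗ[ℝ] ℝ) (U : ⋀[ℝ]^k W) :
    pairing ξ (exteriorPower.map k T U) = pairing (ξ.compLinearMap T) U := by
  suffices h : pairing ξ ∘ₗ exteriorPower.map k T = pairing (ξ.compLinearMap T) from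
    LinearMap.congr_fun h U
  refine exteriorPower.linearMap_ext (AlternatingMap.ext fun v => ?_)
  simp [pairing, exteriorPower.map_apply_ιMulti]
  rfl

theorem eq_of_pairing_eq {k : ℕ} {U U' : ⋀[ℝ]^k W} (h : ∀ ξ, pairing ξ U = pairing ξ U') :
    U = U' := by
  refine (Module.forall_dual_apply_eq_zero_iff ℝ (U - U')).1 (fun f => ?_) |> sub_eq_zero.1
  obtain ⟨ξ, rfl⟩ := exteriorPower.alternatingMapLinearEquiv.surjective f
  rw [map_sub, sub_eq_zero]
  exact h ξ

theorem wedge_add_left {p q : ℕ} (θ θ' : W [⋀^Fin p]→ₗ[ℝ] ℝ) (ξ : W [⋀^Fin q]→ₗ[ℝ] ℝ) :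
    wedge (θ + θ') ξ = wedge θ ξ + wedge θ' ξ := by
  ext v
  simp only [wedge_apply, AlternatingMap.add_apply, ← Finset.sum_add_distrib]
  refine Finset.sum_congr rfl fun σ _ => ?_
  induction σ using Quotient.inductionOn' with | _ σ
  simp only [mul'_domCoprod_summand_mk, AlternatingMap.add_apply]
  ring

theorem wedge_smul_left {p q : ℕ} (c : ℝ) (θ : W [⋀^Fin p]→ₗ[ℝ] ℝ) (ξ : W [⋀^Fin q]→ₗ[ℝ] ℝ) :
    wedge (c • θ) ξ = c • wedge θ ξ := by
  ext v
  simp only [wedge_apply, AlternatingMap.smul_apply, Finset.smul_sum]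
  refine Finset.sum_congr rfl fun σ _ => ?_
  induction σ using Quotient.inductionOn' with | _ σ
  simp only [mul'_domCoprod_summand_mk, AlternatingMap.smul_apply, smul_eq_mul]
  ring

/-- The contraction with a fixed multivector, as a linear map in the form. -/
def contractRight {l k n : ℕ} (h : l + k = n) (U : ⋀[ℝ]^n W) :
    (W [⋀^Fin l]→ₗ[ℝ] ℝ) →ₗ[ℝ] ⋀[ℝ]^k W where
  toFun θ := contract h θ U
  map_add' θ θ' := by
    subst h
    refine eq_of_pairing_eq fun ξ => ?_
    simp only [pairing_contract, map_add, wedge_add_left]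
    simp only [pairing, map_add, LinearMap.add_apply]
  map_smul' c θ := by
    subst h
    refine eq_of_pairing_eq fun ξ => ?_
    simp only [pairing_contract, map_smul, wedge_smul_left, RingHom.id_apply]
    simp only [pairing, map_smul, LinearMap.smul_apply]

@[simp]
theorem contractRight_apply {l k n : ℕ} (h : l + k = n) (U : ⋀[ℝ]^n W)
    (θ : W [⋀^Fin l]→ₗ[ℝ] ℝ) : contractRight h U θ = contract h θ U := rfl

theorem contract_add_left {l k n : ℕ} (h : l + k = n) (θ θ' : W [⋀^Fin l]→ₗ[ℝ] ℝ) (U : ⋀[ℝ]^n W) :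
    contract h (θ + θ') U = contract h θ U + contract h θ' U :=
  map_add (contractRight h U) θ θ'

theorem contract_smul_left {l k n : ℕ} (h : l + k = n) (c : ℝ) (θ : W [⋀^Fin l]→ₗ[ℝ] ℝ)
    (U : ⋀[ℝ]^n W) : contract h (c • θ) U = c • contract h θ U :=
  map_smul (contractRight h U) c θ

theorem wedge_compLinearMap {p q : ℕ} (T : W →ₗ[ℝ] W') (θ : W' [⋀^Fin p]→ₗ[ℝ] ℝ)
    (ξ : W' [⋀^Fin q]→ₗ[ℝ] ℝ) :
    (wedge θ ξ).compLinearMap T = wedge (θ.compLinearMap T) (ξ.compLinearMap T) := by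
  ext v
  rw [AlternatingMap.compLinearMap_apply, wedge_apply, wedge_apply]
  refine Finset.sum_congr rfl fun σ _ => ?_
  induction σ using Quotient.inductionOn' with | _ σ
  rw [mul'_domCoprod_summand_mk, mul'_domCoprod_summand_mk]
  rfl

/-- Contraction is natural for linear maps `T` with a left inverse `S`. It is applied to local
trivialisations, for which `S` is an honest inverse only over the base set. -/
theorem map_contract {l k n : ℕ} (h : l + k = n) (T : W →ₗ[ℝ] W') (S : W' →ₗ[ℝ] W)
    (hST : S ∘ₗ T = .id) (θ : W [⋀^Fin l]→ₗ[ℝ] ℝ) (U : ⋀[ℝ]^n W) :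
    exteriorPower.map k T (contract h θ U) =
      contract h (θ.compLinearMap S) (exteriorPower.map n T U) := by
  subst h
  refine eq_of_pairing_eq fun ξ => ?_
  rw [pairing_map, pairing_contract, pairing_contract, pairing_map, wedge_compLinearMap]
  have hθ : (θ.compLinearMap S).compLinearMap T = θ := by
    ext v
    simp only [AlternatingMap.compLinearMap_apply, ← LinearMap.comp_apply, hST, LinearMap.id_apply]
  rw [hθ]

/-- The value of a `q`-form on the first `q` vectors of a basis is the value on the whole basis of
its wedge product with some `k`-form, namely with the determinant in the last `k` coordinates, for
which a single shuffle contributes. -/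
theorem exists_wedge_apply_eq {q k : ℕ} (b : Module.Basis (Fin q ⊕ Fin k) ℝ W)
    (θ : W [⋀^Fin q]→ₗ[ℝ] ℝ) :
    ∃ ξ : W [⋀^Fin k]→ₗ[ℝ] ℝ,
      wedge θ ξ (b ∘ finSumFinEquiv.symm) = θ (fun i => b (.inl i)) := by
  let ξ : W [⋀^Fin k]→ₗ[ℝ] ℝ := (Matrix.detRowAlternating (n := Fin k) (R := ℝ)).compLinearMap
    (LinearMap.pi fun j => b.coord (.inr j))
  have hξ : ∀ v, ξ v = Matrix.det (Matrix.of fun i j => b.coord (.inr j) (v i)) := fun v => rfl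
  have hv : (b ∘ finSumFinEquiv.symm) ∘ finSumFinEquiv = b := by ext; simp
  refine ⟨ξ, ?_⟩
  rw [wedge_apply, hv]
  refine (Fintype.sum_eq_single (Quotient.mk'' 1) fun σ hσ => ?_).trans ?_
  · -- a shuffle other than the trivial one feeds one of the first `q` basis vectors to `ξ`
    induction σ using Quotient.inductionOn' with | _ σ
    have : ∃ i j, σ (.inr i) = .inl j := by
      by_contra! hcon
      refine hσ (Quotient.sound' ?_)
      rw [QuotientGroup.leftRel_apply]
      have : σ ∈ (Equiv.Perm.sumCongrHom (Fin q) (Fin k)).range := by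
        apply Equiv.Perm.mem_sumCongrHom_range_of_perm_mapsTo_inl
        rw [Equiv.Perm.perm_mapsTo_inl_iff_mapsTo_inr]
        rintro _ ⟨i, rfl⟩
        rcases hi : σ (.inr i) with j | j
        · exact absurd hi (hcon i j)
        · exact ⟨j, rfl⟩
      simpa using this
    obtain ⟨i, j, hij⟩ := this
    rw [mul'_domCoprod_summand_mk, hξ, Matrix.det_eq_zero_of_row_eq_zero i]
    · simp
    · intro l
      simp [hij]
  · have h1 :
        (Matrix.of fun i j => b.coord (.inr j) (b (.inr i)) : Matrix (Fin k) (Fin k) ℝ) = 1 := by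
      ext i j
      simp [Module.Basis.repr_self, Finsupp.single_apply, Matrix.one_apply]
    rw [mul'_domCoprod_summand_mk]
    simp only [Equiv.Perm.coe_one, id, hξ, h1]
    simp

/-- Contraction of forms with a nonzero element of the top exterior power is injective. -/
theorem contractRight_injective {q k n : ℕ} [FiniteDimensional ℝ W] (hn : Module.finrank ℝ W = n)
    (h : q + k = n) {Λ : ⋀[ℝ]^n W} (hΛ : Λ ≠ 0) : Function.Injective (contractRight h Λ) := by
  rw [injective_iff_map_eq_zero]
  intro θ hθ
  by_contra hne
  let b := Module.finBasisOfFinrankEq ℝ W hn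
  obtain ⟨s, hs, hsθ⟩ : ∃ s : Fin q → Fin n, Function.Injective s ∧ θ (fun i => b (s i)) ≠ 0 := by
    by_contra! hcon
    exact hne (b.ext_alternating fun s hs => by simpa using hcon s hs)
  -- complete the `q` basis vectors on which `θ` does not vanish by the remaining ones
  obtain ⟨e, he⟩ : ∃ e : Fin q ⊕ Fin k ≃ Fin n, ∀ i, e (.inl i) = s i := by
    have hcard : Fintype.card (Fin k) = Fintype.card ↥(Set.range s)ᶜ := by
      rw [Fintype.card_compl_set, Set.card_range_of_injective hs]
      simp only [Fintype.card_fin]; omega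
    exact ⟨((Equiv.ofInjective s hs).sumCongr (Fintype.equivOfCardEq hcard)).trans
      (Equiv.Set.sumCompl (Set.range s)), fun i => by simp⟩
  let b' := b.reindex e.symm
  obtain ⟨ξ, hξ⟩ := exists_wedge_apply_eq b' θ
  subst h
  have hone : Module.finrank ℝ (⋀[ℝ]^(q + k) W) = 1 := by
    rw [exteriorPower.finrank_eq, hn, Nat.choose_self]
  -- `Λ` spans the top exterior power, so `⟨θ ∧ ξ, Λ⟩ = ⟨ξ, θ ⌟ Λ⟩ = 0` kills the wedge of the basis
  obtain ⟨c, hc⟩ := (finrank_eq_one_iff_of_nonzero' Λ hΛ).1 hone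
    (exteriorPower.ιMulti ℝ _ (b' ∘ finSumFinEquiv.symm))
  have h0 : pairing (wedge θ ξ) (c • Λ) = 0 := by
    rw [← pairing_contract, map_smul, ← contractRight_apply, hθ, smul_zero, map_zero]
  rw [hc, pairing, exteriorPower.alternatingMapLinearEquiv_apply_ιMulti, hξ] at h0
  exact hsθ (by simpa [b', he] using h0)

theorem finrank_alternatingMap {q n : ℕ} [FiniteDimensional ℝ W] (hn : Module.finrank ℝ W = n) :
    Module.finrank ℝ (W [⋀^Fin q]→ₗ[ℝ] ℝ) = n.choose q := by
  rw [(exteriorPower.alternatingMapLinearEquiv (R := ℝ) (M := W) (N := ℝ) (n := q)).finrank_eq,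
    ← hn, ← exteriorPower.finrank_eq ℝ]
  exact Subspace.dual_finrank_eq

instance [FiniteDimensional ℝ W] (q : ℕ) : FiniteDimensional ℝ (W [⋀^Fin q]→ₗ[ℝ] ℝ) :=
  Module.Finite.equiv
    (exteriorPower.alternatingMapLinearEquiv (R := ℝ) (M := W) (N := ℝ) (n := q)).symm

/-- Contraction with a nonzero element `Λ` of the top exterior power is a linear isomorphism from
`q`-forms to `k`-vectors. -/
def contractEquiv {q k n : ℕ} [FiniteDimensional ℝ W] (hn : Module.finrank ℝ W = n)
    (h : q + k = n) {Λ : ⋀[ℝ]^n W} (hΛ : Λ ≠ 0) :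
    (W [⋀^Fin q]→ₗ[ℝ] ℝ) ≃ₗ[ℝ] ⋀[ℝ]^k W :=
  LinearMap.linearEquivOfInjective (contractRight h Λ) (contractRight_injective hn h hΛ) (by
    rw [finrank_alternatingMap hn, exteriorPower.finrank_eq, hn, ← h, Nat.choose_symm_add])

@[simp]
theorem contractEquiv_apply {q k n : ℕ} [FiniteDimensional ℝ W] (hn : Module.finrank ℝ W = n)
    (h : q + k = n) {Λ : ⋀[ℝ]^n W} (hΛ : Λ ≠ 0) (θ : W [⋀^Fin q]→ₗ[ℝ] ℝ) :
    contractEquiv hn h hΛ θ = contract h θ Λ := rfl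

end FibreAlgebra

/-! ### Smooth sections, smooth forms and cut-offs -/

theorem alternatingMap_apply_eq_sum {W : Type*} [AddCommGroup W] [Module ℝ W] {ι : Type*}
    [Fintype ι] (b : Module.Basis ι ℝ W) {k : ℕ} (f : W [⋀^Fin k]→ₗ[ℝ] ℝ) (v : Fin k → W) :
    f v = ∑ J : Fin k → ι, (∏ i, b.repr (v i) (J i)) * f (fun i => b (J i)) := by
  classical
  conv_lhs => rw [show v = fun i => ∑ j, b.repr (v i) j • b j from
    funext fun i => (b.sum_repr (v i)).symm]
  rw [← AlternatingMap.coe_multilinearMap, MultilinearMap.map_sum]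
  refine Finset.sum_congr rfl fun J _ => ?_
  rw [MultilinearMap.map_smul_univ, smul_eq_mul]

/-- An alternating form on a finite-dimensional normed space is continuous. -/
def toContinuousAlternatingMap {F : Type*} [NormedAddCommGroup F] [NormedSpace ℝ F]
    [FiniteDimensional ℝ F] {k : ℕ} (f : F [⋀^Fin k]→ₗ[ℝ] ℝ) : F [⋀^Fin k]→L[ℝ] ℝ where
  toMultilinearMap := f.toMultilinearMap
  cont := by
    have h : (fun v => f v) = fun v => ∑ J : Fin k → Fin (Module.finrank ℝ F),
        (∏ i, (Module.finBasis ℝ F).repr (v i) (J i)) *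
          f (fun i => (Module.finBasis ℝ F) (J i)) :=
      funext fun v => alternatingMap_apply_eq_sum _ f v
    change Continuous fun v => f v
    rw [h]
    refine continuous_finsetSum _ fun J _ => (continuous_finsetProd _ fun i _ => ?_).mul
      continuous_const
    exact ((Module.finBasis ℝ F).coord (J i)).continuous_of_finiteDimensional.comp
      (continuous_apply i)
  map_eq_zero_of_eq' := f.map_eq_zero_of_eq'

@[simp]
theorem toContinuousAlternatingMap_apply {F : Type*} [NormedAddCommGroup F] [NormedSpace ℝ F]
    [FiniteDimensional ℝ F] {k : ℕ} (f : F [⋀^Fin k]→ₗ[ℝ] ℝ) (v : Fin k → F) :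
    toContinuousAlternatingMap f v = f v := rfl

section Bundles

variable {E : Type*} [NormedAddCommGroup E] [NormedSpace ℝ E]
  {H : Type*} [TopologicalSpace H] {I : ModelWithCorners ℝ E H}
  {M : Type*} [TopologicalSpace M] [ChartedSpace H M]
  {F : Type*} [NormedAddCommGroup F] [NormedSpace ℝ F] [FiniteDimensional ℝ F]

/-- A map into the alternating forms on a finite-dimensional space is smooth as soon as all its
evaluations are. -/
theorem contMDiffAt_continuousAlternatingMap_iff {k : ℕ} {f : M → F [⋀^Fin k]→L[ℝ] ℝ} {x₀ : M} :
    ContMDiffAt I 𝓘(ℝ, F [⋀^Fin k]→L[ℝ] ℝ) ∞ f x₀ ↔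
      ∀ w : Fin k → F, ContMDiffAt I 𝓘(ℝ, ℝ) ∞ (fun y => f y w) x₀ := by
  constructor
  · intro hf w
    exact (ContinuousAlternatingMap.apply ℝ F ℝ w).contMDiff.contMDiffAt.comp x₀ hf
  · intro hf
    let b := Module.finBasis ℝ F
    -- the values on tuples of basis vectors embed the forms linearly in a space of functions
    let Φ : (F [⋀^Fin k]→L[ℝ] ℝ) →ₗ[ℝ] ((Fin k → Fin (Module.finrank ℝ F)) → ℝ) :=
      LinearMap.pi fun J => (ContinuousAlternatingMap.apply ℝ F ℝ (fun i => b (J i))).toLinearMap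
    have hΦ : LinearMap.ker Φ = ⊥ := by
      rw [LinearMap.ker_eq_bot']
      intro g hg
      ext v
      have := alternatingMap_apply_eq_sum b g.toAlternatingMap v
      rw [Finset.sum_eq_zero] at this
      · simpa using this
      · intro J _
        have h2 := congrFun hg J
        simp only [Φ, LinearMap.pi_apply] at h2
        rw [show g.toAlternatingMap (fun i => b (J i)) = 0 from h2, mul_zero]
    obtain ⟨L, hL⟩ := Φ.exists_leftInverse_of_injective hΦ
    have h1 : ContMDiffAt I 𝓘(ℝ, (Fin k → Fin (Module.finrank ℝ F)) → ℝ) ∞ (fun y => Φ (f y)) x₀ :=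
      contMDiffAt_pi_space.2 fun J => hf _
    have h2 := (LinearMap.toContinuousLinearMap L).contMDiff.contMDiffAt.comp (n := ∞) x₀ h1
    refine h2.congr_of_eventuallyEq (.of_forall fun y => ?_)
    exact (LinearMap.congr_fun hL (f y)).symm

variable {V : M → Type*} [TopologicalSpace (TotalSpace F V)]
  [∀ x, AddCommGroup (V x)] [∀ x, Module ℝ (V x)] [∀ x, TopologicalSpace (V x)]
  [FiberBundle F V] [VectorBundle ℝ F V]

/-- A family of alternating forms on the fibres is smooth at `x₀` if and only if its values on the
constant sections of the local trivialisation at `x₀` are. -/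
theorem contMDiffAt_form_iff {k : ℕ} (η : ∀ x : M, V x [⋀^Fin k]→L[ℝ] Trivial M ℝ x) (x₀ : M) :
    ContMDiffAt I (I.prod 𝓘(ℝ, F [⋀^Fin k]→L[ℝ] ℝ)) ∞
      (fun x => TotalSpace.mk' (F [⋀^Fin k]→L[ℝ] ℝ) x (η x)) x₀ ↔
      ∀ w : Fin k → F, ContMDiffAt I 𝓘(ℝ, ℝ) ∞
        (fun y => (η y : V y [⋀^Fin k]→L[ℝ] ℝ)
          (fun i => (trivializationAt F V x₀).symm y (w i))) x₀ := by
  rw [contMDiffAt_section, contMDiffAt_continuousAlternatingMap_iff]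
  refine forall_congr' fun w => Filter.EventuallyEq.contMDiffAt_iff ?_
  filter_upwards [(trivializationAt F V x₀).open_baseSet.mem_nhds
    (FiberBundle.mem_baseSet_trivializationAt' x₀)] with y hy
  rw [FiberBundle.trivializationAt_continuousAlternatingMap_apply]
  simp only [ContinuousAlternatingMap.inCoordinates]
  simp [Function.comp_def, hy, Trivialization.symm_apply]

theorem form_at_apply {k : ℕ} (η : Form I F V k) (x : M) (v : Fin k → V x) :
    η.at x v = (η x : V x [⋀^Fin k]→L[ℝ] ℝ) v := rfl

theorem form_at_add {k : ℕ} (η ξ : Form I F V k) (x : M) : (η + ξ).at x = η.at x + ξ.at x := rfl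

theorem form_at_smul {k : ℕ} (c : ℝ) (η : Form I F V k) (x : M) : (c • η).at x = c • η.at x := rfl

theorem form_ext {k : ℕ} {η ξ : Form I F V k} (h : ∀ x, η.at x = ξ.at x) : η = ξ := by
  refine ContMDiffSection.ext fun x => ContinuousAlternatingMap.ext fun v => ?_
  exact DFunLike.congr_fun (h x) v

/-- A `k`-form from a family of alternating forms on the fibres that is smooth when evaluated on
the constant sections of local trivialisations. Each form is continuous because the fibre
is isomorphic to the finite-dimensional model fibre. -/
def Form.mk' {k : ℕ} (η : ∀ x : M, V x [⋀^Fin k]→ₗ[ℝ] ℝ)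
    (hη : ∀ (x₀ : M) (w : Fin k → F), ContMDiffAt I 𝓘(ℝ, ℝ) ∞
      (fun y => η y (fun i => (trivializationAt F V x₀).symm y (w i))) x₀) : Form I F V k where
  toFun x := ((toContinuousAlternatingMap ((η x).compLinearMap
      (VectorBundle.continuousLinearEquivAt ℝ F V x).symm.toLinearMap)).compContinuousLinearMap
        (VectorBundle.continuousLinearEquivAt ℝ F V x : V x →L[ℝ] F) : V x [⋀^Fin k]→L[ℝ] ℝ)
  contMDiff_toFun x₀ := by
    rw [contMDiffAt_form_iff]
    intro w
    simpa [Trivialization.symm_apply_apply_mk, FiberBundle.mem_baseSet_trivializationAt']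
      using hη x₀ w

@[simp]
theorem Form.mk'_at {k : ℕ} (η : ∀ x : M, V x [⋀^Fin k]→ₗ[ℝ] ℝ)
    (hη : ∀ (x₀ : M) (w : Fin k → F), ContMDiffAt I 𝓘(ℝ, ℝ) ∞
      (fun y => η y (fun i => (trivializationAt F V x₀).symm y (w i))) x₀) (x : M) :
    (Form.mk' (I := I) η hη).at x = η x := by
  ext v
  simp [Form.mk', form_at_apply, Trivialization.symm_apply_apply_mk,
    FiberBundle.mem_baseSet_trivializationAt']

theorem contMDiffAt_trivialization_coord (X : Sec I F V) (ℓ : F →ₗ[ℝ] ℝ) {x₀ x : M}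
    [ContMDiffVectorBundle ∞ F V I]
    (hx : x ∈ (trivializationAt F V x₀).baseSet) : ContMDiffAt I 𝓘(ℝ, ℝ) ∞
      (fun y => ℓ (trivializationAt F V x₀ ⟨y, X y⟩).2) x := by
  have h := (Trivialization.contMDiffAt_section_iff (trivializationAt F V x₀) hx).1
    (X.contMDiff x)
  exact (LinearMap.toContinuousLinearMap ℓ).contMDiff.contMDiffAt.comp (n := ∞) x h

theorem eq_sum_trivialization_symm {ι : Type*} [Fintype ι] (b : Module.Basis ι ℝ F) {x₀ y : M}
    (hy : y ∈ (trivializationAt F V x₀).baseSet) (v : V y) :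
    v = ∑ j, b.repr (trivializationAt F V x₀ ⟨y, v⟩).2 j •
      (trivializationAt F V x₀).symm y (b j) := by
  set e := trivializationAt F V x₀
  have h1 : e.symmₗ ℝ y (e ⟨y, v⟩).2 = v := by
    rw [Trivialization.coe_symmₗ _ hy]
    exact e.symm_apply_apply_mk hy v
  conv_lhs => rw [← h1, ← b.sum_repr (e ⟨y, v⟩).2]
  simp only [map_sum, map_smul, Trivialization.coe_symmₗ _ hy]

/-- The value of a smooth form on smooth sections is smooth. -/
theorem contMDiff_form_apply {k : ℕ} [ContMDiffVectorBundle ∞ F V I] (η : Form I F V k)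
    (X : Fin k → Sec I F V) :
    ContMDiff I 𝓘(ℝ, ℝ) ∞ (fun y => η.at y (fun i => X i y)) := by
  intro x₀
  let b := Module.finBasis ℝ F
  have hx₀ := FiberBundle.mem_baseSet_trivializationAt' (F := F) (E := V) x₀
  have hη := (contMDiffAt_form_iff (fun x => η x) x₀).1 (η.contMDiff x₀)
  have h : ContMDiffAt I 𝓘(ℝ, ℝ) ∞ (fun y => ∑ J : Fin k → Fin (Module.finrank ℝ F),
      (∏ i, b.coord (J i) (trivializationAt F V x₀ ⟨y, X i y⟩).2) *
        η.at y (fun i => (trivializationAt F V x₀).symm y (b (J i)))) x₀ := by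
    refine ContMDiffAt.sum fun J _ => ContMDiffAt.mul (ContMDiffAt.prod fun i _ => ?_) (hη _)
    exact contMDiffAt_trivialization_coord (X i) _ hx₀
  refine h.congr_of_eventuallyEq ?_
  filter_upwards [(trivializationAt F V x₀).open_baseSet.mem_nhds hx₀] with y hy
  have hX : (fun i => X i y) = fun i => ∑ j, b.repr (trivializationAt F V x₀ ⟨y, X i y⟩).2 j •
      (trivializationAt F V x₀).symm y (b j) :=
    funext fun i => eq_sum_trivialization_symm b hy _
  conv_lhs => rw [hX]
  rw [← AlternatingMap.coe_multilinearMap, MultilinearMap.map_sum]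
  refine Finset.sum_congr rfl fun J _ => ?_
  rw [MultilinearMap.map_smul_univ, smul_eq_mul]
  rfl

variable [FiniteDimensional ℝ E] [T2Space M] [IsManifold I ∞ M]

theorem exists_bump (x₀ : M) {s : Set M} (hs : s ∈ 𝓝 x₀) :
    ∃ ρ : C^∞⟮I, M; ℝ⟯, (∀ᶠ y in 𝓝 x₀, ρ y = 1) ∧ tsupport ρ ⊆ s := by
  obtain ⟨f, hf, -⟩ := (SmoothBumpFunction.nhds_basis_support (I := I) hs).mem_iff.1
    (Filter.univ_mem (f := 𝓝 x₀))
  exact ⟨⟨f, f.contMDiff⟩, f.eventuallyEq_one, hf⟩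

variable (I F V) in
/-- A smooth function that is `1` near `x₀` and is supported in the domain of the preferred local
trivialisation of `V` at `x₀`. -/
def bump (x₀ : M) : C^∞⟮I, M; ℝ⟯ :=
  (exists_bump x₀ ((trivializationAt F V x₀).open_baseSet.mem_nhds
    (FiberBundle.mem_baseSet_trivializationAt' x₀))).choose

theorem bump_eventuallyEq_one (x₀ : M) : ∀ᶠ y in 𝓝 x₀, bump I F V x₀ y = 1 :=
  (exists_bump x₀ ((trivializationAt F V x₀).open_baseSet.mem_nhds
    (FiberBundle.mem_baseSet_trivializationAt' x₀))).choose_spec.1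

theorem bump_self (x₀ : M) : bump I F V x₀ x₀ = 1 := (bump_eventuallyEq_one x₀).self_of_nhds

theorem tsupport_bump_subset (x₀ : M) :
    tsupport (bump I F V x₀) ⊆ (trivializationAt F V x₀).baseSet :=
  (exists_bump x₀ ((trivializationAt F V x₀).open_baseSet.mem_nhds
    (FiberBundle.mem_baseSet_trivializationAt' x₀))).choose_spec.2

theorem bump_eq_zero (x₀ : M) {y : M} (hy : y ∉ (trivializationAt F V x₀).baseSet) :
    bump I F V x₀ y = 0 := by
  by_contra h
  exact hy (tsupport_bump_subset x₀ (subset_tsupport _ h))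

variable [ContMDiffVectorBundle ∞ F V I]

variable (I V) in
/-- The global section that is the constant section `w` of the local trivialisation at `x₀`, cut
off by `bump x₀`. -/
def cutoffSection (x₀ : M) : F →ₗ[ℝ] Sec I F V where
  toFun w := ⟨fun y => bump I F V x₀ y • (trivializationAt F V x₀).symmₗ ℝ y w, by
    refine ContMDiffOn.smul_section_of_tsupport (u := (trivializationAt F V x₀).baseSet)
      (bump I F V x₀).contMDiff.contMDiffOn (trivializationAt F V x₀).open_baseSet
      (tsupport_bump_subset x₀) ?_
    rw [Trivialization.contMDiffOn_section_baseSet_iff]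
    refine (contMDiffOn_const (c := w)).congr fun y hy => ?_
    simp [Trivialization.symmₗ_apply _ hy, hy]⟩
  map_add' w w' := by
    ext y
    simp [ContMDiffSection.coe_add]
  map_smul' c w := by
    ext y
    simp [ContMDiffSection.coe_smul, smul_comm c]

theorem cutoffSection_apply (x₀ : M) (w : F) (y : M) : cutoffSection I V x₀ w y =
    bump I F V x₀ y • (trivializationAt F V x₀).symmₗ ℝ y w := rfl

theorem cutoffSection_eventuallyEq (x₀ : M) : ∀ᶠ y in 𝓝 x₀, ∀ w : F,
    cutoffSection I V x₀ w y = (trivializationAt F V x₀).symm y w := by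
  filter_upwards [bump_eventuallyEq_one (I := I) (F := F) (V := V) x₀,
    (trivializationAt F V x₀).open_baseSet.mem_nhds
      (FiberBundle.mem_baseSet_trivializationAt' x₀)] with y hy hy' w
  rw [cutoffSection_apply, hy, one_smul, Trivialization.coe_symmₗ _ hy']

variable (I F) in
/-- A linear choice of a global section through each vector of the fibre at `x₀`. -/
def extendSection (x₀ : M) : V x₀ →ₗ[ℝ] Sec I F V :=
  cutoffSection I V x₀ ∘ₗ (trivializationAt F V x₀).linearMapAt ℝ x₀

@[simp]
theorem extendSection_self (x₀ : M) (v : V x₀) : extendSection I F x₀ v x₀ = v := by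
  have hx₀ := FiberBundle.mem_baseSet_trivializationAt' (F := F) (E := V) x₀
  rw [extendSection, LinearMap.comp_apply, cutoffSection_apply, bump_self, one_smul,
    Trivialization.symmₗ_linearMapAt _ hx₀]

/-- Up to a factor `ρ` with `ρ x₀ = 1`, a section is a combination of global sections with smooth
coefficients that vanish at `x₀` if the section does. -/
theorem exists_fsmul_eq_sum (x₀ : M) (X : Sec I F V) :
    ∃ (ρ : C^∞⟮I, M; ℝ⟯) (c : Fin (Module.finrank ℝ F) → C^∞⟮I, M; ℝ⟯)
      (S : Fin (Module.finrank ℝ F) → Sec I F V), ρ x₀ = 1 ∧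
      X.fsmul ρ = ∑ j, (S j).fsmul (c j) ∧ (X x₀ = 0 → ∀ j, c j x₀ = 0) := by
  let b := Module.finBasis ℝ F
  let e := trivializationAt F V x₀
  have hc : ∀ j, ContMDiff I 𝓘(ℝ, ℝ) ∞
      fun y => bump I F V x₀ y * b.coord j (e ⟨y, X y⟩).2 := fun j => by
    refine contMDiff_of_tsupport fun y hy => ?_
    refine (bump I F V x₀).contMDiff.contMDiffAt.mul (contMDiffAt_trivialization_coord X _ ?_)
    exact tsupport_bump_subset x₀ (tsupport_mul_subset_left hy)
  -- one factor of the bump function cuts off the coordinates, the other the frame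
  refine ⟨bump I F V x₀ * bump I F V x₀, fun j => ⟨_, hc j⟩,
    fun j => cutoffSection I V x₀ (b j), ?_, ?_, ?_⟩
  · simp [bump_self]
  · ext y
    have hsum : (∑ j, (cutoffSection I V x₀ (b j)).fsmul
        (⟨fun y => bump I F V x₀ y * b.coord j (e ⟨y, X y⟩).2, hc j⟩ : C^∞⟮I, M; ℝ⟯)) y =
        ∑ j, (bump I F V x₀ y * b.coord j (e ⟨y, X y⟩).2) • cutoffSection I V x₀ (b j) y :=
      map_sum ((Pi.evalAddMonoidHom V y).comp (ContMDiffSection.coeAddHom I F ∞ V)) _ _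
    rw [hsum]
    change (bump I F V x₀ y * bump I F V x₀ y) • X y = _
    by_cases hy : y ∈ e.baseSet
    · conv_lhs => rw [eq_sum_trivialization_symm b hy (X y), Finset.smul_sum]
      refine Finset.sum_congr rfl fun j _ => ?_
      rw [cutoffSection_apply, Trivialization.coe_symmₗ _ hy, smul_smul, smul_smul]
      congr 1
      simp only [Module.Basis.coord_apply]
      ring
    · simp [bump_eq_zero x₀ hy]
  · intro hX j
    have h0 : (e ⟨x₀, X x₀⟩).2 = 0 := by
      rw [hX]
      exact (congrFun (Trivialization.coe_linearMapAt_of_mem (R := ℝ) e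
        (FiberBundle.mem_baseSet_trivializationAt' x₀)) 0).symm.trans (map_zero _)
    change bump I F V x₀ x₀ * b.coord j (e ⟨x₀, X x₀⟩).2 = 0
    rw [h0, map_zero, mul_zero]

end Bundles

/-! ### Tensorial maps on sections, and the anchor -/

section Tensorial

variable {E : Type*} [NormedAddCommGroup E] [NormedSpace ℝ E]
  {H : Type*} [TopologicalSpace H] {I : ModelWithCorners ℝ E H}
  {M : Type*} [TopologicalSpace M] [ChartedSpace H M]
  {F : Type*} [NormedAddCommGroup F] [NormedSpace ℝ F] [FiniteDimensional ℝ F]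
  {V : M → Type*} [TopologicalSpace (TotalSpace F V)]
  [∀ x, AddCommGroup (V x)] [∀ x, Module ℝ (V x)] [∀ x, TopologicalSpace (V x)]
  [FiberBundle F V] [VectorBundle ℝ F V]

theorem Sec.fsmul_apply (f : C^∞⟮I, M; ℝ⟯) (X : Sec I F V) (x : M) : X.fsmul f x = f x • X x := rfl

variable (I F V) in
/-- Evaluation of sections at a point, as a linear map. -/
def evalSection (x : M) : Sec I F V →ₗ[ℝ] V x where
  toFun X := X x
  map_add' _ _ := rfl
  map_smul' _ _ := rfl

variable (I M) in
/-- Evaluation of smooth functions at a point, as a linear map. -/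
def evalFunction (x : M) : C^∞⟮I, M; ℝ⟯ →ₗ[ℝ] ℝ where
  toFun f := f x
  map_add' _ _ := rfl
  map_smul' _ _ := rfl

@[simp] theorem evalFunction_apply (x : M) (f : C^∞⟮I, M; ℝ⟯) : evalFunction I M x f = f x := rfl

/-- A `k`-form as an alternating map on sections with values in smooth functions. -/
def Form.onSections [ContMDiffVectorBundle ∞ F V I] {k : ℕ} (η : Form I F V k) :
    Sec I F V [⋀^Fin k]→ₗ[ℝ] C^∞⟮I, M; ℝ⟯ where
  toFun X := ⟨fun y => η.at y (fun i => X i y), contMDiff_form_apply η X⟩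
  map_update_add' X i Y Z := by
    ext y
    exact ((η.at y).compLinearMap (evalSection I F V y)).map_update_add X i Y Z
  map_update_smul' X i c Y := by
    ext y
    exact ((η.at y).compLinearMap (evalSection I F V y)).map_update_smul X i c Y
  map_eq_zero_of_eq' X i j h hij := by
    ext y
    exact ((η.at y).compLinearMap (evalSection I F V y)).map_eq_zero_of_eq X h hij

theorem Form.onSections_apply [ContMDiffVectorBundle ∞ F V I] {k : ℕ} (η : Form I F V k)
    (X : Fin k → Sec I F V) (y : M) : η.onSections X y = η.at y (fun i => X i y) := rfl

/-- An alternating map on sections is tensorial if it is linear over the smooth functions. -/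
def IsTensorial {k : ℕ} (G : Sec I F V [⋀^Fin k]→ₗ[ℝ] C^∞⟮I, M; ℝ⟯) : Prop :=
  ∀ (f : C^∞⟮I, M; ℝ⟯) (X : Fin k → Sec I F V) (i : Fin k) (Y : Sec I F V),
    G (Function.update X i (Y.fsmul f)) = f * G (Function.update X i Y)

theorem Form.isTensorial_onSections [ContMDiffVectorBundle ∞ F V I] {k : ℕ} (η : Form I F V k) :
    IsTensorial η.onSections := by
  intro f X i Y
  ext y
  have h : ∀ Z : Sec I F V, η.onSections (Function.update X i Z) y =
      η.at y (Function.update (fun j => X j y) i (Z y)) := fun Z => by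
    rw [Form.onSections_apply]
    congr 1
    ext j
    rcases eq_or_ne j i with rfl | hj
    · simp
    · simp [hj]
  rw [ContMDiffMap.coe_mul, Pi.mul_apply, h, h, Sec.fsmul_apply, AlternatingMap.map_update_smul,
    smul_eq_mul]

/-- By antisymmetry, tensoriality may be checked in the first argument. -/
theorem isTensorial_of_vecCons {k : ℕ} {G : Sec I F V [⋀^Fin (k + 1)]→ₗ[ℝ] C^∞⟮I, M; ℝ⟯}
    (hG : ∀ (f : C^∞⟮I, M; ℝ⟯) (Y : Sec I F V) (X : Fin k → Sec I F V),
      G (Matrix.vecCons (Y.fsmul f) X) = f * G (Matrix.vecCons Y X)) : IsTensorial G := by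
  intro f X i Y
  have h : ∀ Z, Function.update X i Z = i.insertNth Z (i.removeNth X) := fun Z => by
    rw [Fin.insertNth_removeNth]
  rw [h, h, AlternatingMap.map_insertNth, AlternatingMap.map_insertNth, hG, mul_smul_comm]

/-- Tensoriality in the first argument, when it is in a list from which a later entry is removed. -/
theorem IsTensorial.removeNth_vecCons {k : ℕ} {G : Sec I F V [⋀^Fin k]→ₗ[ℝ] C^∞⟮I, M; ℝ⟯}
    (hG : IsTensorial G) (f : C^∞⟮I, M; ℝ⟯) (Y : Sec I F V) (X : Fin k → Sec I F V) (j : Fin k) :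
    G (j.succ.removeNth (Matrix.vecCons (Y.fsmul f) X : Fin (k + 1) → Sec I F V)) =
      f * G (j.succ.removeNth (Matrix.vecCons Y X : Fin (k + 1) → Sec I F V)) := by
  cases k with
  | zero => exact j.elim0
  | succ k =>
    have h : ∀ Z, j.succ.removeNth (Matrix.vecCons Z X : Fin (k + 2) → Sec I F V) =
        Function.update (j.succ.removeNth (Matrix.vecCons Y X : Fin (k + 2) → Sec I F V)) 0 Z := by
      intro Z
      ext i : 1
      refine Fin.cases ?_ (fun i => ?_) i
      · simp [Fin.removeNth]
      · simp [Fin.removeNth]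
    rw [h (Y.fsmul f), hG, ← h Y]

variable [FiniteDimensional ℝ E] [T2Space M] [IsManifold I ∞ M] [ContMDiffVectorBundle ∞ F V I]

/-- A tensorial map vanishes at `x` if one of its arguments does: near `x` that argument is a
combination of sections with coefficients vanishing at `x`. -/
theorem IsTensorial.eq_zero {k : ℕ} {G : Sec I F V [⋀^Fin k]→ₗ[ℝ] C^∞⟮I, M; ℝ⟯}
    (hG : IsTensorial G) {X : Fin k → Sec I F V} {i : Fin k} {x : M} (hX : X i x = 0) :
    G X x = 0 := by
  obtain ⟨ρ, c, S, hρ, hsum, hc⟩ := exists_fsmul_eq_sum x (X i)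
  have h1 : (ρ * G (Function.update X i (X i))) x =
      (∑ j, c j * G (Function.update X i (S j))) x := by
    rw [← hG, hsum, AlternatingMap.map_update_sum]
    exact congrArg (fun g : C^∞⟮I, M; ℝ⟯ => g x) (Finset.sum_congr rfl fun j _ => hG _ _ _ _)
  rw [Function.update_eq_self, ContMDiffMap.coe_mul, Pi.mul_apply, hρ, one_mul] at h1
  rw [h1, ← evalFunction_apply, map_sum]
  exact Finset.sum_eq_zero fun j _ => by simp [hc hX j]

/-- The value at `x` of a tensorial alternating map depends only on the values at `x`. -/
theorem IsTensorial.congr {k : ℕ} {G : Sec I F V [⋀^Fin k]→ₗ[ℝ] C^∞⟮I, M; ℝ⟯}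
    (hG : IsTensorial G) {X Y : Fin k → Sec I F V} {x : M} (h : ∀ i, X i x = Y i x) :
    G X x = G Y x := by
  classical
  -- exchange the arguments one at a time
  suffices hs : ∀ s : Finset (Fin k), G (s.piecewise X Y) x = G Y x by
    simpa using hs Finset.univ
  intro s
  induction s using Finset.induction_on with
  | empty => simp
  | insert i s hi ih =>
    rw [← ih, Finset.piecewise_insert, ← sub_eq_zero]
    set Z := s.piecewise X Y
    have hZ : Z = Function.update Z i (Y i) := by
      rw [← Finset.piecewise_eq_of_notMem s X Y hi, Function.update_eq_self]
    have : G (Function.update Z i (X i - Y i)) x = 0 :=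
      hG.eq_zero (i := i) (by simp [ContMDiffSection.coe_sub, h i])
    rw [← this, AlternatingMap.map_update_sub, ← hZ]
    rfl

/-- The form determined by a tensorial alternating map on sections. -/
def IsTensorial.toForm {k : ℕ} {G : Sec I F V [⋀^Fin k]→ₗ[ℝ] C^∞⟮I, M; ℝ⟯}
    (hG : IsTensorial G) : Form I F V k :=
  Form.mk' (fun x => ((evalFunction I M x).compAlternatingMap G).compLinearMap
    (extendSection I F x)) fun x₀ w => by
    refine (G fun i => cutoffSection I V x₀ (w i)).contMDiff.contMDiffAt.congr_of_eventuallyEq ?_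
    filter_upwards [cutoffSection_eventuallyEq (I := I) (F := F) (V := V) x₀] with y hy
    exact hG.congr fun i => by simp [hy]

theorem IsTensorial.toForm_at {k : ℕ} {G : Sec I F V [⋀^Fin k]→ₗ[ℝ] C^∞⟮I, M; ℝ⟯}
    (hG : IsTensorial G) (X : Fin k → Sec I F V) (x : M) :
    hG.toForm.at x (fun i => X i x) = G X x := by
  rw [IsTensorial.toForm, Form.mk'_at]
  exact hG.congr fun i => by simp

theorem form_ext_onSections {k : ℕ} {η ξ : Form I F V k} {x : M}
    (h : ∀ X : Fin k → Sec I F V, η.at x (fun i => X i x) = ξ.at x (fun i => X i x)) :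
    η.at x = ξ.at x := by
  ext v
  simpa using h fun i => extendSection I F x (v i)

end Tensorial

section Anchor

variable {E : Type*} [NormedAddCommGroup E] [NormedSpace ℝ E]
  {H : Type*} [TopologicalSpace H] {I : ModelWithCorners ℝ E H}
  {M : Type*} [TopologicalSpace M] [ChartedSpace H M] [IsManifold I ∞ M]
  {F : Type*} [NormedAddCommGroup F] [NormedSpace ℝ F] [FiniteDimensional ℝ F]
  {V : M → Type*} [TopologicalSpace (TotalSpace F V)]
  [∀ x, AddCommGroup (V x)] [∀ x, Module ℝ (V x)] [∀ x, TopologicalSpace (V x)]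
  [FiberBundle F V] [VectorBundle ℝ F V]

namespace LieAlgebroid

variable (𝒜 : LieAlgebroid I F V)

theorem contMDiff_deriv (X : Sec I F V) (f : C^∞⟮I, M; ℝ⟯) :
    ContMDiff I 𝓘(ℝ, ℝ) ∞ (fun x => 𝒜.deriv X f x) := by
  have h1 : ContMDiff I I.tangent ∞
      (fun x => (⟨x, 𝒜.anchor x (X x)⟩ : TangentBundle I M)) :=
    𝒜.contMDiff_anchor.comp X.contMDiff
  have h2 : ContMDiff I.tangent (𝓘(ℝ, ℝ)).tangent ∞ (tangentMap I 𝓘(ℝ, ℝ) f) :=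
    f.contMDiff.contMDiff_tangentMap (by simp)
  exact (contMDiff_snd_tangentBundle_modelSpace ℝ 𝓘(ℝ, ℝ)).comp (h2.comp h1)

theorem mdifferentiableAt_contMDiffMap (f : C^∞⟮I, M; ℝ⟯) (x : M) :
    MDifferentiableAt I 𝓘(ℝ, ℝ) f x := f.contMDiff.contMDiffAt.mdifferentiableAt (by simp)

/-- The action `f ↦ a(X) f` of sections on smooth functions through the anchor. -/
def anchorAction : Sec I F V →ₗ[ℝ] C^∞⟮I, M; ℝ⟯ →ₗ[ℝ] C^∞⟮I, M; ℝ⟯ :=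
  LinearMap.mk₂ ℝ (fun X f => ⟨fun x => 𝒜.deriv X f x, 𝒜.contMDiff_deriv X f⟩)
    (fun X Y f => by
      ext x
      change mfderiv I 𝓘(ℝ, ℝ) f x (𝒜.anchor x (X x + Y x)) = _
      rw [map_add, map_add]
      rfl)
    (fun c X f => by
      ext x
      change mfderiv I 𝓘(ℝ, ℝ) f x (𝒜.anchor x (c • X x)) = _
      rw [map_smul, map_smul]
      rfl)
    (fun X f g => by
      ext x
      change mfderiv I 𝓘(ℝ, ℝ) (⇑f + ⇑g) x (𝒜.anchor x (X x)) = _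
      rw [mfderiv_add (mdifferentiableAt_contMDiffMap f x) (mdifferentiableAt_contMDiffMap g x)]
      rfl)
    (fun c X f => by
      ext x
      change mfderiv I 𝓘(ℝ, ℝ) (c • ⇑f) x (𝒜.anchor x (X x)) = _
      rw [const_smul_mfderiv (mdifferentiableAt_contMDiffMap f x)]
      rfl)

theorem anchorAction_apply (X : Sec I F V) (f : C^∞⟮I, M; ℝ⟯) (x : M) :
    𝒜.anchorAction X f x = 𝒜.deriv X f x := rfl

theorem anchorAction_mul (X : Sec I F V) (f g : C^∞⟮I, M; ℝ⟯) :
    𝒜.anchorAction X (f * g) = 𝒜.anchorAction X f * g + f * 𝒜.anchorAction X g := by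
  ext x
  change mfderiv I 𝓘(ℝ, ℝ) (⇑f * ⇑g) x (𝒜.anchor x (X x)) = _
  rw [((mdifferentiableAt_contMDiffMap f x).hasMFDerivAt.mul
    (mdifferentiableAt_contMDiffMap g x).hasMFDerivAt).mfderiv]
  change f x * 𝒜.deriv X g x + g x * 𝒜.deriv X f x =
    𝒜.deriv X f x * g x + f x * 𝒜.deriv X g x
  ring

theorem anchorAction_fsmul (X : Sec I F V) (f g : C^∞⟮I, M; ℝ⟯) :
    𝒜.anchorAction (X.fsmul f) g = f * 𝒜.anchorAction X g := by
  ext x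
  change mfderiv I 𝓘(ℝ, ℝ) g x (𝒜.anchor x (f x • X x)) = _
  rw [map_smul, map_smul]
  rfl

theorem bracket_skew (X Y : Sec I F V) : 𝒜.bracket X Y = -𝒜.bracket Y X := by
  have h := 𝒜.bracket_self (X + Y)
  simp only [map_add, LinearMap.add_apply, 𝒜.bracket_self, zero_add, add_zero] at h
  exact eq_neg_of_add_eq_zero_right h

theorem bracket_fsmul_left (X Y : Sec I F V) (f : C^∞⟮I, M; ℝ⟯) :
    𝒜.bracket (X.fsmul f) Y = (𝒜.bracket X Y).fsmul f - X.fsmul (𝒜.anchorAction Y f) := by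
  ext x
  rw [bracket_skew, ContMDiffSection.coe_neg, Pi.neg_apply, 𝒜.leibniz, bracket_skew,
    ContMDiffSection.coe_sub]
  simp only [ContMDiffSection.coe_neg, Pi.neg_apply, Pi.sub_apply, Sec.fsmul_apply,
    anchorAction_apply, LieAlgebroid.deriv]
  module

theorem bracket_fsmul_right (X Y : Sec I F V) (f : C^∞⟮I, M; ℝ⟯) :
    𝒜.bracket X (Y.fsmul f) = (𝒜.bracket X Y).fsmul f + Y.fsmul (𝒜.anchorAction X f) := by
  ext x
  rw [𝒜.leibniz]
  rfl

end LieAlgebroid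
end Anchor

/-! ### Existence and uniqueness of the Lie algebroid differential -/

section Differential

variable {E : Type*} [NormedAddCommGroup E] [NormedSpace ℝ E]
  {H : Type*} [TopologicalSpace H] {I : ModelWithCorners ℝ E H}
  {M : Type*} [TopologicalSpace M] [ChartedSpace H M] [IsManifold I ∞ M]
  {F : Type*} [NormedAddCommGroup F] [NormedSpace ℝ F] [FiniteDimensional ℝ F]
  {V : M → Type*} [TopologicalSpace (TotalSpace F V)]
  [∀ x, AddCommGroup (V x)] [∀ x, Module ℝ (V x)] [∀ x, TopologicalSpace (V x)]
  [FiberBundle F V] [VectorBundle ℝ F V] [ContMDiffVectorBundle ∞ F V I]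

theorem IsTensorial.curryLeft {k : ℕ} {G : Sec I F V [⋀^Fin (k + 1)]→ₗ[ℝ] C^∞⟮I, M; ℝ⟯}
    (hG : IsTensorial G) (W : Sec I F V) : IsTensorial (AlternatingMap.curryLeft G W) := by
  intro f X i Y
  have h : ∀ Z, AlternatingMap.curryLeft G W (Function.update X i Z) =
      G (Function.update (Matrix.vecCons W X : Fin (k + 1) → Sec I F V) i.succ Z) := fun Z => by
    rw [AlternatingMap.curryLeft_apply_apply]
    congr 1
    exact Fin.cons_update (α := fun _ => Sec I F V) W X i Z
  rw [h, h, hG]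

theorem IsTensorial.curryLeft_fsmul {k : ℕ} {G : Sec I F V [⋀^Fin (k + 1)]→ₗ[ℝ] C^∞⟮I, M; ℝ⟯}
    (hG : IsTensorial G) (f : C^∞⟮I, M; ℝ⟯) (W : Sec I F V) (X : Fin k → Sec I F V) :
    AlternatingMap.curryLeft G (W.fsmul f) X = f * AlternatingMap.curryLeft G W X := by
  have h := hG f (Matrix.vecCons W X) 0 W
  simpa [Matrix.vecCons] using h

/-- An alternatisation evaluated on a list with first entry `Z`, with the term for `Z` split off. -/
theorem alternatizeUncurryFin_vecCons {L N : Type*} [AddCommGroup L] [Module ℝ L] [AddCommGroup N]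
    [Module ℝ N] {k : ℕ} (G : L →ₗ[ℝ] L [⋀^Fin k]→ₗ[ℝ] N) (Z : L) (X : Fin k → L) :
    AlternatingMap.alternatizeUncurryFin G (Matrix.vecCons Z X) =
      G Z X - ∑ i : Fin k, (-1) ^ (i : ℕ) • G (X i) (i.succ.removeNth (Matrix.vecCons Z X)) := by
  simp [AlternatingMap.alternatizeUncurryFin_apply, Fin.sum_univ_succ, pow_succ, sub_eq_add_neg]

namespace LieAlgebroid

open AlternatingMap (alternatizeUncurryFin alternatizeUncurryFinLM alternatizeUncurryFin_apply
  alternatizeUncurryFin_alternatizeUncurryFinLM_comp_apply curryLeft curryLeft_apply_apply)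

variable (𝒜 : LieAlgebroid I F V)

/-- The part of the Lie algebroid differential in which the anchor differentiates the values of
the form. -/
def anchorPart {k : ℕ} (η : Form I F V k) : Sec I F V [⋀^Fin (k + 1)]→ₗ[ℝ] C^∞⟮I, M; ℝ⟯ :=
  alternatizeUncurryFin
    { toFun := fun X => (𝒜.anchorAction X).compAlternatingMap η.onSections
      map_add' := fun X Y => by rw [map_add]; rfl
      map_smul' := fun c X => by rw [map_smul]; rfl }

/-- The part of the Lie algebroid differential that involves the bracket. Alternating the two
arguments of the bracket counts every pair twice, with the opposite sign. -/
def bracketPart : ∀ {k : ℕ}, Form I F V k → Sec I F V [⋀^Fin (k + 1)]→ₗ[ℝ] C^∞⟮I, M; ℝ⟯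
  | 0, _ => 0
  | _ + 1, η => (-(1 / 2) : ℝ) • alternatizeUncurryFin
      (alternatizeUncurryFinLM ∘ₗ 𝒜.bracket.compr₂ (curryLeft η.onSections))

theorem anchorPart_apply {k : ℕ} (η : Form I F V k) (X : Fin (k + 1) → Sec I F V) (x : M) :
    𝒜.anchorPart η X x = ∑ i : Fin (k + 1), (-1 : ℝ) ^ (i : ℕ) *
        𝒜.deriv (X i) (fun y => η.at y (fun l : Fin k => X (i.succAbove l) y)) x := by
  rw [anchorPart, alternatizeUncurryFin_apply, ← evalFunction_apply, map_sum]
  refine Finset.sum_congr rfl fun i _ => ?_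
  rw [map_zsmul, zsmul_eq_mul]
  push_cast
  rfl

theorem bracketPart_apply {k : ℕ} (η : Form I F V k) (X : Fin (k + 1) → Sec I F V) (x : M) :
    𝒜.bracketPart η X x = 𝒜.bracketSum η X x := by
  cases k with
  | zero => rfl
  | succ k =>
    rw [bracketPart, AlternatingMap.smul_apply,
      alternatizeUncurryFin_alternatizeUncurryFinLM_comp_apply, bracketSum,
      Fin.sum_univ_castSucc (n := k + 1)]
    -- no pair `i ≤ j'` has `i` equal to the last index, and that term of the outer sum vanishes
    have hlast : ∀ j' : Fin (k + 1), ¬ Fin.last (k + 1) ≤ j'.castSucc := fun j' =>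
      not_le.2 (Fin.castSucc_lt_last j')
    simp only [hlast, if_false, Finset.sum_const_zero, add_zero, Fin.castSucc_le_castSucc_iff]
    rw [← evalFunction_apply, map_smul, map_sum, Finset.smul_sum]
    refine Finset.sum_congr rfl fun i _ => ?_
    rw [← Finset.sum_filter, map_sum, Finset.smul_sum]
    refine Finset.sum_congr (by ext; simp) fun j _ => ?_
    simp only [LinearMap.compr₂_apply, 𝒜.bracket_skew (X j.succ) (X i.castSucc), map_neg,
      AlternatingMap.neg_apply, sub_neg_eq_add, curryLeft_apply_apply]
    rw [map_zsmul, map_add, evalFunction_apply, Form.onSections_apply, zsmul_eq_mul]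
    have hcons : (fun l => (Matrix.vecCons (𝒜.bracket (X i.castSucc) (X j.succ))
        (j.removeNth (i.castSucc.removeNth X)) : Fin (k + 1) → Sec I F V) l x) =
        Fin.cons (𝒜.bracket (X i.castSucc) (X j.succ) x)
          (fun l : Fin k => X (i.castSucc.succAbove (j.succAbove l)) x) := by
      ext l
      induction l using Fin.cases with
      | zero => rfl
      | succ l => rfl
    rw [hcons]
    push_cast
    rw [smul_eq_mul, Fin.val_castSucc, Fin.val_succ]
    ring

/-- The alternating map on sections given by the formula for the Lie algebroid differential. -/
def koszul {k : ℕ} (η : Form I F V k) : Sec I F V [⋀^Fin (k + 1)]→ₗ[ℝ] C^∞⟮I, M; ℝ⟯ :=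
  𝒜.anchorPart η + 𝒜.bracketPart η

/-- The failure of the anchor part to be linear over functions in the first argument. -/
theorem anchorPart_fsmul {k : ℕ} (η : Form I F V k) (f : C^∞⟮I, M; ℝ⟯) (Y : Sec I F V)
    (X : Fin k → Sec I F V) :
    𝒜.anchorPart η (Matrix.vecCons (Y.fsmul f) X) = f * 𝒜.anchorPart η (Matrix.vecCons Y X) -
      ∑ i : Fin k, (-1) ^ (i : ℕ) • (𝒜.anchorAction (X i) f *
        η.onSections (i.succ.removeNth (Matrix.vecCons Y X : Fin (k + 1) → Sec I F V))) := by
  simp only [anchorPart, alternatizeUncurryFin_apply, Fin.sum_univ_succ, mul_add, Finset.mul_sum,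
    LinearMap.coe_mk, AddHom.coe_mk, LinearMap.compAlternatingMap_apply, Matrix.cons_val_zero,
    Matrix.cons_val_succ, η.isTensorial_onSections.removeNth_vecCons, anchorAction_mul,
    anchorAction_fsmul]
  rw [add_sub_assoc, ← Finset.sum_sub_distrib]
  congr 1
  · simp
  · refine Finset.sum_congr rfl fun i _ => ?_
    simp only [Fin.val_succ, pow_succ, zsmul_eq_mul]
    push_cast
    ring

/-- The failure of the bracket part to be linear over functions in the first argument; it cancels
that of the anchor part. -/
theorem bracketPart_fsmul {k : ℕ} (η : Form I F V k) (f : C^∞⟮I, M; ℝ⟯) (Y : Sec I F V)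
    (X : Fin k → Sec I F V) :
    𝒜.bracketPart η (Matrix.vecCons (Y.fsmul f) X) = f * 𝒜.bracketPart η (Matrix.vecCons Y X) +
      ∑ i : Fin k, (-1) ^ (i : ℕ) • (𝒜.anchorAction (X i) f *
        η.onSections (i.succ.removeNth (Matrix.vecCons Y X : Fin (k + 1) → Sec I F V))) := by
  cases k with
  | zero => simp [bracketPart]
  | succ k =>
    have hrem : ∀ (Z : Sec I F V) (i : Fin (k + 1)),
        i.succ.removeNth (Matrix.vecCons Z X : Fin (k + 2) → Sec I F V) =
          Matrix.vecCons Z (i.removeNth X) := fun Z i => by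
      ext l : 1
      induction l using Fin.cases with
      | zero => simp [Fin.removeNth]
      | succ l => simp [Fin.removeNth]
    -- the pairs with `Y` in the first or in the second slot of the bracket contribute `S` each
    have key : ∀ A B S : C^∞⟮I, M; ℝ⟯, A = f * B - (2 : ℝ) • S →
        (-(1 / 2) : ℝ) • A = f * ((-(1 / 2) : ℝ) • B) + S := by
      rintro A B S rfl
      rw [smul_sub, smul_smul, mul_smul_comm]
      norm_num
    have hη := η.isTensorial_onSections
    rw [bracketPart, AlternatingMap.smul_apply, AlternatingMap.smul_apply]
    refine key _ _ _ ?_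
    simp only [alternatizeUncurryFin_vecCons, LinearMap.comp_apply, hrem,
      AlternatingMap.alternatizeUncurryFinLM_apply]
    simp only [LinearMap.compr₂_apply, alternatizeUncurryFin_apply,
      (hη.curryLeft _).removeNth_vecCons, bracket_fsmul_left, bracket_fsmul_right, map_sub, map_add,
      AlternatingMap.sub_apply, AlternatingMap.add_apply, hη.curryLeft_fsmul, two_smul]
    simp only [curryLeft_apply_apply (x := Y), zsmul_eq_mul, mul_sub, Finset.mul_sum,
      Finset.sum_sub_distrib, mul_add, Finset.sum_add_distrib, mul_left_comm f]
    abel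

theorem isTensorial_koszul {k : ℕ} (η : Form I F V k) : IsTensorial (𝒜.koszul η) :=
  isTensorial_of_vecCons fun f Y X => by
    rw [koszul, AlternatingMap.add_apply, AlternatingMap.add_apply, anchorPart_fsmul,
      bracketPart_fsmul]
    ring

theorem koszul_add {k : ℕ} (η ξ : Form I F V k) : 𝒜.koszul (η + ξ) = 𝒜.koszul η + 𝒜.koszul ξ := by
  have h : ∀ X, (η + ξ).onSections X = η.onSections X + ξ.onSections X := fun X => rfl
  refine AlternatingMap.ext fun X => ?_
  cases k <;>
    simp [koszul, anchorPart, bracketPart, alternatizeUncurryFin_apply, h, smul_add,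
      Finset.sum_add_distrib]
  abel

theorem koszul_smul {k : ℕ} (c : ℝ) (η : Form I F V k) : 𝒜.koszul (c • η) = c • 𝒜.koszul η := by
  have h : ∀ X, (c • η).onSections X = c • η.onSections X := fun X => rfl
  refine AlternatingMap.ext fun X => ?_
  cases k <;>
    simp [koszul, anchorPart, bracketPart, alternatizeUncurryFin_apply, h, smul_add,
      Finset.smul_sum, smul_comm c]

variable [FiniteDimensional ℝ E] [T2Space M]

theorem exists_isDifferential (k : ℕ) : ∃ d, 𝒜.IsDifferential k d := by
  refine ⟨{ toFun := fun η => (𝒜.isTensorial_koszul η).toForm, map_add' := fun η ξ => ?_,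
            map_smul' := fun c η => ?_ }, fun η X x => ?_⟩
  · refine form_ext fun x => form_ext_onSections fun X => ?_
    rw [form_at_add, AlternatingMap.add_apply]
    simp only [IsTensorial.toForm_at, koszul_add]
    rfl
  · refine form_ext fun x => form_ext_onSections fun X => ?_
    rw [form_at_smul, AlternatingMap.smul_apply]
    simp only [IsTensorial.toForm_at, koszul_smul]
    rfl
  · refine ((𝒜.isTensorial_koszul η).toForm_at X x).trans ?_
    rw [← anchorPart_apply, ← bracketPart_apply]
    rfl

theorem existsUnique_isDifferential (k : ℕ) : ∃! d, 𝒜.IsDifferential k d := by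
  obtain ⟨d, hd⟩ := 𝒜.exists_isDifferential k
  refine ⟨d, hd, fun d' hd' => LinearMap.ext fun η => form_ext fun x =>
    form_ext_onSections fun X => ?_⟩
  rw [hd, hd']

theorem isDifferential_differential (k : ℕ) : 𝒜.IsDifferential k (𝒜.differential k) := by
  have h := 𝒜.exists_isDifferential k
  rw [differential, dif_pos h]
  exact h.choose_spec

end LieAlgebroid
end Differential

/-! ### The isomorphism between forms and multivector fields -/

section Star

variable {E : Type*} [NormedAddCommGroup E] [NormedSpace ℝ E]
  {H : Type*} [TopologicalSpace H] {I : ModelWithCorners ℝ E H}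
  {M : Type*} [TopologicalSpace M] [ChartedSpace H M]
  {F : Type*} [NormedAddCommGroup F] [NormedSpace ℝ F] [FiniteDimensional ℝ F]
  {V : M → Type*} [TopologicalSpace (TotalSpace F V)]
  [∀ x, AddCommGroup (V x)] [∀ x, Module ℝ (V x)] [∀ x, TopologicalSpace (V x)]
  [FiberBundle F V] [VectorBundle ℝ F V]

theorem finrank_fibre {n : ℕ} (hn : Module.finrank ℝ F = n) (x : M) :
    Module.finrank ℝ (V x) = n := by
  rw [← hn]
  exact (VectorBundle.continuousLinearEquivAt ℝ F V x).toLinearEquiv.finrank_eq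

/-- The top exterior power of an `n`-dimensional space is spanned by one element `Ω`, the
coefficient being the pairing with an `n`-form `τ`. -/
theorem exists_pairing_smul_eq {n : ℕ} (hn : Module.finrank ℝ F = n) :
    ∃ (τ : F [⋀^Fin n]→ₗ[ℝ] ℝ) (Ω : ⋀[ℝ]^n F), Ω ≠ 0 ∧ ∀ U, U = pairing τ U • Ω := by
  have hone : Module.finrank ℝ (⋀[ℝ]^n F) = 1 := by
    rw [exteriorPower.finrank_eq, hn, Nat.choose_self]
  have : Nontrivial (⋀[ℝ]^n F) := Module.nontrivial_of_finrank_pos (R := ℝ) (by omega)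
  obtain ⟨Ω, hΩ⟩ := exists_ne (0 : ⋀[ℝ]^n F)
  obtain ⟨f, hf⟩ := Module.Projective.exists_dual_eq_one ℝ hΩ
  obtain ⟨τ, rfl⟩ := exteriorPower.alternatingMapLinearEquiv.surjective f
  refine ⟨τ, Ω, hΩ, fun U => ?_⟩
  obtain ⟨c, rfl⟩ := (finrank_eq_one_iff_of_nonzero' Ω hΩ).1 hone U
  rw [map_smul, pairing, hf, smul_eq_mul, mul_one]

/-- A linear functional of a form read in a local trivialisation is smooth. -/
theorem contMDiffAt_linear_comp_alternatingMap {k : ℕ} {f : M → F [⋀^Fin k]→ₗ[ℝ] ℝ} {x₀ : M}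
    (hf : ∀ w, ContMDiffAt I 𝓘(ℝ, ℝ) ∞ (fun y => f y w) x₀)
    (ℓ : (F [⋀^Fin k]→ₗ[ℝ] ℝ) →ₗ[ℝ] ℝ) :
    ContMDiffAt I 𝓘(ℝ, ℝ) ∞ (fun y => ℓ (f y)) x₀ := by
  have hfin : FiniteDimensional ℝ (F [⋀^Fin k]→L[ℝ] ℝ) :=
    FiniteDimensional.of_injective
      (ContinuousAlternatingMap.toAlternatingMapLinear (R := ℝ) (A := ℝ) (M := F) (N := ℝ)
        (ι := Fin k)) ContinuousAlternatingMap.toAlternatingMap_injective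
  have h := (contMDiffAt_continuousAlternatingMap_iff (I := I) (x₀ := x₀)
    (f := fun y => toContinuousAlternatingMap (f y))).2 hf
  exact (LinearMap.toContinuousLinearMap (ℓ ∘ₗ ContinuousAlternatingMap.toAlternatingMapLinear
    (R := ℝ) (A := ℝ) (M := F) (N := ℝ) (ι := Fin k))).contMDiff.contMDiffAt.comp (n := ∞) x₀ h

theorem symmL_comp_linearMapAt {x₀ y : M} (hy : y ∈ (trivializationAt F V x₀).baseSet) :
    (trivializationAt F V x₀).symmₗ ℝ y ∘ₗ (trivializationAt F V x₀).linearMapAt ℝ y = .id :=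
  LinearMap.ext fun v => Trivialization.symmₗ_linearMapAt _ hy v

theorem eventually_mem_baseSet (x₀ : M) : ∀ᶠ y in 𝓝 x₀, y ∈ (trivializationAt F V x₀).baseSet :=
  (trivializationAt F V x₀).open_baseSet.mem_nhds
    (FiberBundle.mem_baseSet_trivializationAt' x₀)

theorem contMDiffAt_form_coord {q : ℕ} (η : Form I F V q) (x₀ : M) (w : Fin q → F) :
    ContMDiffAt I 𝓘(ℝ, ℝ) ∞ (fun y =>
      (η.at y).compLinearMap ((trivializationAt F V x₀).symmₗ ℝ y) w) x₀ := by
  refine ((contMDiffAt_form_iff (fun x => η x) x₀).1 (η.contMDiff x₀) w).congr_of_eventuallyEq ?_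
  filter_upwards [eventually_mem_baseSet (F := F) (V := V) x₀] with y hy
  simp only [AlternatingMap.compLinearMap_apply, Trivialization.coe_symmₗ _ hy]
  rfl

/-- The contraction of a smooth form with a smooth section of the top exterior power is smooth:
in a local trivialisation it is a smooth function times a constant linear image of the form. -/
theorem isSmoothMultivector_contract {q k n : ℕ} (hn : Module.finrank ℝ F = n) (h : q + k = n)
    (η : Form I F V q) (Λ : Multivector I F V n) :
    IsSmoothMultivector I F V k fun x => contract h (η.at x) (Λ.1 x) := by
  intro x₀ φ
  obtain ⟨τ, Ω, -, hΩ⟩ := exists_pairing_smul_eq hn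
  have hη := contMDiffAt_linear_comp_alternatingMap (contMDiffAt_form_coord η x₀)
    (pairing φ ∘ₗ contractRight h Ω)
  refine ((Λ.2 x₀ τ).mul hη).congr_of_eventuallyEq ?_
  filter_upwards [eventually_mem_baseSet (F := F) (V := V) x₀] with y hy
  rw [map_contract h _ _ (symmL_comp_linearMapAt hy), hΩ (exteriorPower.map n _ (Λ.1 y)), map_smul,
    map_smul]
  rfl

theorem map_linearMapAt_ne_zero {n : ℕ} {x₀ y : M} (hy : y ∈ (trivializationAt F V x₀).baseSet)
    {U : ⋀[ℝ]^n (V y)} (hU : U ≠ 0) :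
    exteriorPower.map n ((trivializationAt F V x₀).linearMapAt ℝ y) U ≠ 0 := by
  rwa [Ne, map_eq_zero_iff _ (exteriorPower.map_injective _ (symmL_comp_linearMapAt hy))]

/-- A section of `∧ⁿA` is a smooth multiple of a nowhere vanishing one. -/
theorem exists_eq_fsmul {n : ℕ} (hn : Module.finrank ℝ F = n) {Λ : Multivector I F V n}
    (hΛ : ∀ x, Λ.1 x ≠ 0) (Λ' : Multivector I F V n) :
    ∃ g : C^∞⟮I, M; ℝ⟯, Λ' = Multivector.fsmul g Λ := by
  have hex : ∀ x, ∃ c : ℝ, c • Λ.1 x = Λ'.1 x := fun x => by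
    have := VectorBundle.finiteDimensional ℝ F V x
    refine (finrank_eq_one_iff_of_nonzero' (Λ.1 x) (hΛ x)).1 ?_ _
    rw [exteriorPower.finrank_eq, finrank_fibre hn, Nat.choose_self]
  choose g hg using hex
  obtain ⟨τ, Ω, -, hΩ⟩ := exists_pairing_smul_eq hn
  refine ⟨⟨g, fun x₀ => ?_⟩, Subtype.ext (funext fun x => (hg x).symm)⟩
  have hne : ∀ y ∈ (trivializationAt F V x₀).baseSet, pairing τ
      (exteriorPower.map n ((trivializationAt F V x₀).linearMapAt ℝ y) (Λ.1 y)) ≠ 0 := by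
    intro y hy h0
    refine map_linearMapAt_ne_zero hy (hΛ y) ?_
    rw [hΩ (exteriorPower.map n _ _), h0, zero_smul]
  refine ((Λ'.2 x₀ τ).div₀ (Λ.2 x₀ τ)
    (hne _ (FiberBundle.mem_baseSet_trivializationAt' x₀))).congr_of_eventuallyEq ?_
  filter_upwards [eventually_mem_baseSet (F := F) (V := V) x₀] with y hy
  rw [Pi.div_apply, ← hg y, map_smul, map_smul, smul_eq_mul]
  exact (mul_div_cancel_right₀ _ (hne y hy)).symm

/-- The fibrewise inverse of `η ↦ η ⌟ Λ` takes smooth multivectors to smooth forms. -/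
theorem contMDiffAt_of_contract_eq {q k n : ℕ} (hn : Module.finrank ℝ F = n) (h : q + k = n)
    {Λ : Multivector I F V n} (hΛ : ∀ x, Λ.1 x ≠ 0) (U : Multivector I F V k)
    (η : ∀ x : M, V x [⋀^Fin q]→ₗ[ℝ] ℝ) (hη : ∀ x, contract h (η x) (Λ.1 x) = U.1 x)
    (x₀ : M) (w : Fin q → F) :
    ContMDiffAt I 𝓘(ℝ, ℝ) ∞
      (fun y => η y (fun i => (trivializationAt F V x₀).symm y (w i))) x₀ := by
  obtain ⟨τ, Ω, hΩ0, hΩ⟩ := exists_pairing_smul_eq hn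
  -- `φ` reads off the value of a form on `w` from its contraction with `Ω`
  let C := contractEquiv hn h hΩ0
  let ev : (F [⋀^Fin q]→ₗ[ℝ] ℝ) →ₗ[ℝ] ℝ :=
    { toFun := fun θ => θ w, map_add' := fun _ _ => rfl, map_smul' := fun _ _ => rfl }
  obtain ⟨φ, hφ⟩ := exteriorPower.alternatingMapLinearEquiv.surjective (ev ∘ₗ C.symm.toLinearMap)
  have hne : ∀ y ∈ (trivializationAt F V x₀).baseSet, pairing τ
      (exteriorPower.map n ((trivializationAt F V x₀).linearMapAt ℝ y) (Λ.1 y)) ≠ 0 := by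
    intro y hy h0
    refine map_linearMapAt_ne_zero hy (hΛ y) ?_
    rw [hΩ (exteriorPower.map n _ _), h0, zero_smul]
  refine ((U.2 x₀ φ).div₀ (Λ.2 x₀ τ)
    (hne _ (FiberBundle.mem_baseSet_trivializationAt' x₀))).congr_of_eventuallyEq ?_
  filter_upwards [eventually_mem_baseSet (F := F) (V := V) x₀] with y hy
  have hC := (map_contract h _ _ (symmL_comp_linearMapAt hy) (η y) (Λ.1 y)).trans
    ((congrArg _ (hΩ _)).trans (map_smul _ _ _))
  rw [Pi.div_apply, eq_div_iff (hne y hy), ← hη y, hC, map_smul]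
  have hφ' : ∀ θ, pairing φ (contract h θ Ω) = θ w := fun θ => by
    rw [pairing, hφ, LinearMap.comp_apply, LinearEquiv.coe_coe, ← contractEquiv_apply hn h hΩ0,
      LinearEquiv.symm_apply_apply]
    rfl
  rw [hφ', smul_eq_mul, mul_comm, AlternatingMap.compLinearMap_apply]
  simp only [Trivialization.coe_symmₗ _ hy]

/-- The isomorphism `* : Γ(∧^qA*) → Γ(∧^kA)`, `*η = η ⌟ Λ`, for a nowhere vanishing section `Λ`
of the top exterior power and `q + k = n`. -/
def starEquiv {n : ℕ} (hn : Module.finrank ℝ F = n) (Λ : Multivector I F V n)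
    (hΛ : ∀ x, Λ.1 x ≠ 0) (q k : ℕ) (h : q + k = n) :
    Form I F V q ≃ₗ[ℝ] Multivector I F V k where
  toFun η := ⟨fun x => contract h (η.at x) (Λ.1 x), isSmoothMultivector_contract hn h η Λ⟩
  map_add' η ξ := Subtype.ext (funext fun x => by
    change contract h ((η + ξ).at x) (Λ.1 x) =
      contract h (η.at x) (Λ.1 x) + contract h (ξ.at x) (Λ.1 x)
    rw [form_at_add, contract_add_left])
  map_smul' c η := Subtype.ext (funext fun x => by
    change contract h ((c • η).at x) (Λ.1 x) = c • contract h (η.at x) (Λ.1 x)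
    rw [form_at_smul, contract_smul_left])
  invFun U := Form.mk' (fun x =>
      have := VectorBundle.finiteDimensional ℝ F V x
      (contractEquiv (finrank_fibre hn x) h (hΛ x)).symm (U.1 x))
    (contMDiffAt_of_contract_eq hn h hΛ U _ fun x => by
      have := VectorBundle.finiteDimensional ℝ F V x
      exact (contractEquiv (finrank_fibre hn x) h (hΛ x)).apply_symm_apply (U.1 x))
  left_inv η := form_ext fun x => by
    have := VectorBundle.finiteDimensional ℝ F V x
    rw [Form.mk'_at]
    exact (contractEquiv (finrank_fibre hn x) h (hΛ x)).symm_apply_apply (η.at x)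
  right_inv U := Subtype.ext (funext fun x => by
    have := VectorBundle.finiteDimensional ℝ F V x
    change contract h ((Form.mk' _ _).at x) (Λ.1 x) = U.1 x
    rw [Form.mk'_at]
    exact (contractEquiv (finrank_fibre hn x) h (hΛ x)).apply_symm_apply (U.1 x))

theorem starEquiv_apply {n : ℕ} (hn : Module.finrank ℝ F = n) (Λ : Multivector I F V n)
    (hΛ : ∀ x, Λ.1 x ≠ 0) (q k : ℕ) (h : q + k = n) (η : Form I F V q) (x : M) :
    (starEquiv hn Λ hΛ q k h η).1 x = contract h (η.at x) (Λ.1 x) := rfl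

theorem subsingleton_multivector {n k : ℕ} (hn : Module.finrank ℝ F = n) (hk : n < k) :
    Subsingleton (Multivector I F V k) := by
  have hx : ∀ x, Subsingleton (⋀[ℝ]^k (V x)) := fun x => by
    have := VectorBundle.finiteDimensional ℝ F V x
    rw [← Module.finrank_zero_iff (R := ℝ), exteriorPower.finrank_eq, finrank_fibre hn,
      Nat.choose_eq_zero_of_lt hk]
  exact ⟨fun U U' => Subtype.ext (funext fun x => Subsingleton.elim _ _)⟩

theorem subsingleton_form {n k : ℕ} (hn : Module.finrank ℝ F = n) (hk : n < k) :
    Subsingleton (Form I F V k) := by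
  have hx : ∀ x, Subsingleton (V x [⋀^Fin k]→ₗ[ℝ] ℝ) := fun x => by
    have := VectorBundle.finiteDimensional ℝ F V x
    rw [← Module.finrank_zero_iff (R := ℝ), finrank_alternatingMap (finrank_fibre hn x),
      Nat.choose_eq_zero_of_lt hk]
  exact ⟨fun η ξ => form_ext fun x => Subsingleton.elim _ _⟩

end Star

/-! ### The generating operator, cycles and boundaries -/

/-- A one-form is the sum of the dual basis with its values as coefficients; here this is wedged
with `θ`. -/
theorem sum_smul_wedge_coord {W : Type*} [AddCommGroup W] [Module ℝ W] {n q : ℕ}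
    (b : Module.Basis (Fin n) ℝ W) (α : W →ₗ[ℝ] ℝ) (θ : W [⋀^Fin q]→ₗ[ℝ] ℝ) :
    ∑ i, α (b i) • wedge (AlternatingMap.ofSubsingleton ℝ W ℝ (0 : Fin 1) (b.coord i)) θ =
      wedge (AlternatingMap.ofSubsingleton ℝ W ℝ (0 : Fin 1) α) θ := by
  let L : (W →ₗ[ℝ] ℝ) →ₗ[ℝ] W [⋀^Fin (1 + q)]→ₗ[ℝ] ℝ :=
    { toFun := fun β => wedge (AlternatingMap.ofSubsingleton ℝ W ℝ (0 : Fin 1) β) θ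
      map_add' := fun β γ => wedge_add_left (AlternatingMap.ofSubsingleton ℝ W ℝ (0 : Fin 1) β)
        (AlternatingMap.ofSubsingleton ℝ W ℝ (0 : Fin 1) γ) θ
      map_smul' := fun c β =>
        wedge_smul_left c (AlternatingMap.ofSubsingleton ℝ W ℝ (0 : Fin 1) β) θ }
  have hα : α = ∑ i, α (b i) • b.coord i := b.ext fun j => by simp
  change _ = L α
  conv_rhs => rw [hα, map_sum]
  exact Finset.sum_congr rfl fun i _ => (map_smul L _ _).symm

section Generating

variable {E : Type*} [NormedAddCommGroup E] [NormedSpace ℝ E] [FiniteDimensional ℝ E]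
  {H : Type*} [TopologicalSpace H] {I : ModelWithCorners ℝ E H}
  {M : Type*} [TopologicalSpace M] [T2Space M] [ChartedSpace H M] [IsManifold I ∞ M]
  {F : Type*} [NormedAddCommGroup F] [NormedSpace ℝ F] [FiniteDimensional ℝ F]
  {V : M → Type*} [TopologicalSpace (TotalSpace F V)]
  [∀ x, AddCommGroup (V x)] [∀ x, Module ℝ (V x)] [∀ x, TopologicalSpace (V x)]
  [FiberBundle F V] [VectorBundle ℝ F V] [ContMDiffVectorBundle ∞ F V I]

namespace LieAlgebroid

variable (𝒜 : LieAlgebroid I F V)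

/-- The bracket term of the differential at `x` depends linearly on the value of the form at `x`
alone. -/
theorem bracketSum_smul {k : ℕ} {η ξ : Form I F V k} {c : ℝ} {x : M} (h : ξ.at x = c • η.at x)
    (X : Fin (k + 1) → Sec I F V) : 𝒜.bracketSum ξ X x = c * 𝒜.bracketSum η X x := by
  cases k with
  | zero => simp [bracketSum]
  | succ k =>
    simp only [bracketSum, Finset.mul_sum]
    refine Finset.sum_congr rfl fun i _ => Finset.sum_congr rfl fun j _ => ?_
    split_ifs
    · rw [h, AlternatingMap.smul_apply, smul_eq_mul]
      ring
    · simp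

theorem deriv_mul (X : Sec I F V) (f g : C^∞⟮I, M; ℝ⟯) (x : M) :
    𝒜.deriv X (fun y => f y * g y) x = 𝒜.deriv X f x * g x + f x * 𝒜.deriv X g x :=
  congrArg (fun φ : C^∞⟮I, M; ℝ⟯ => φ x) (𝒜.anchorAction_mul X f g)

/-- The differential of a function along the anchor, as a one-form at `x`. -/
def anchorDifferential (g : C^∞⟮I, M; ℝ⟯) (x : M) : V x →ₗ[ℝ] ℝ :=
  (mfderiv I 𝓘(ℝ, ℝ) g x).toLinearMap ∘ₗ 𝒜.anchor x

theorem anchorDifferential_apply (g : C^∞⟮I, M; ℝ⟯) (x : M) (X : Sec I F V) :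
    𝒜.anchorDifferential g x (X x) = 𝒜.deriv X g x := rfl

/-- The Leibniz rule `d(gη) = dg ∧ η + g dη`, for a form that agrees with `gη` near `x`. -/
theorem differential_at_of_eventuallyEq_smul {q : ℕ} {η ξ : Form I F V q} {g : C^∞⟮I, M; ℝ⟯}
    {x : M} (h : ∀ᶠ y in 𝓝 x, ξ.at y = g y • η.at y) :
    (𝒜.differential q ξ).at x = g x • (𝒜.differential q η).at x +
      (wedge (AlternatingMap.ofSubsingleton ℝ (V x) ℝ (0 : Fin 1) (𝒜.anchorDifferential g x))
        (η.at x)).domDomCongr (finCongr (Nat.add_comm 1 q)) := by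
  ext v
  obtain ⟨X, rfl⟩ : ∃ X : Fin (q + 1) → Sec I F V, v = fun i => X i x :=
    ⟨fun i => extendSection I F x (v i), by ext i; simp⟩
  rw [AlternatingMap.add_apply, AlternatingMap.smul_apply, AlternatingMap.domDomCongr_apply,
    wedge_ofSubsingleton_apply, 𝒜.isDifferential_differential, 𝒜.isDifferential_differential,
    𝒜.bracketSum_smul h.self_of_nhds, smul_eq_mul, mul_add, add_right_comm, Finset.mul_sum,
    ← Finset.sum_add_distrib]
  congr 1
  refine Finset.sum_congr rfl fun i _ => ?_
  have hd : 𝒜.deriv (X i) (fun y => ξ.at y (fun l => X (i.succAbove l) y)) x =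
      𝒜.deriv (X i) (fun y => g y * η.onSections (fun l => X (i.succAbove l)) y) x := by
    have he : (fun y => ξ.at y (fun l => X (i.succAbove l) y)) =ᶠ[𝓝 x]
        fun y => g y * η.onSections (fun l => X (i.succAbove l)) y := by
      filter_upwards [h] with y hy
      rw [hy]
      rfl
    simp only [LieAlgebroid.deriv, dirDeriv, he.mfderiv_eq]
    rfl
  rw [hd, deriv_mul, anchorDifferential_apply]
  have ho : ∀ y, η.onSections (fun l => X (i.succAbove l)) y =
      η.at y (fun l => X (i.succAbove l) y) := fun y => rfl
  simp only [ho]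
  ring_nf
  rfl

variable {𝒜}

/-- For a horizontal nowhere vanishing section `Λ` the operator `-(-1)^q * d *⁻¹` satisfies the
defining property of the generating operator: writing `Λ' = gΛ`, the connection term becomes
`(dg ∧ η) ⌟ Λ` and the Leibniz rule for `d(gη)` gives the formula. -/
theorem isGeneratingOperator_star {n : ℕ} (hn : Module.finrank ℝ F = n) (nabla : 𝒜.Connection n)
    (Λ : Multivector I F V n) (hΛ : ∀ x, Λ.1 x ≠ 0) (hhor : ∀ X, nabla.toFun X Λ = 0)
    (q k : ℕ) (h : q + (k + 1) = n) (h' : q + 1 + k = n) :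
    IsGeneratingOperator nabla k (-((-1 : ℝ) ^ q • ((starEquiv hn Λ hΛ (q + 1) k h').toLinearMap ∘ₗ
      𝒜.differential q ∘ₗ (starEquiv hn Λ hΛ q (k + 1) h).symm.toLinearMap))) := by
  intro q' hq' U η Λ' x _ hU X b hX
  obtain rfl : q' = q := by omega
  obtain ⟨g, rfl⟩ := exists_eq_fsmul hn hΛ Λ'
  -- `ξ = *⁻¹ U` equals `gη` near `x`
  set ξ := (starEquiv hn Λ hΛ q' (k + 1) h).symm U with hξ
  have hξU : ∀ y, contract h (ξ.at y) (Λ.1 y) = U.1 y := fun y => by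
    rw [← starEquiv_apply hn Λ hΛ q' (k + 1) h, hξ, LinearEquiv.apply_symm_apply]
  have hξη : ∀ᶠ y in 𝓝 x, ξ.at y = g y • η.at y := by
    filter_upwards [hU] with y hy
    have := VectorBundle.finiteDimensional ℝ F V y
    refine contractRight_injective (finrank_fibre hn y) h (hΛ y) ?_
    rw [contractRight_apply, hξU, hy, contractRight_apply, contract_smul_left]
    exact map_smul _ _ _
  have hnabla : ∀ i, (nabla.toFun (X i) (Multivector.fsmul g Λ)).1 x =
      𝒜.anchorDifferential g x (b i) • Λ.1 x := fun i => by
    rw [nabla.leibniz, hhor, ← hX i, anchorDifferential_apply]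
    exact add_eq_left.2 (smul_zero _)
  change -((-1 : ℝ) ^ q' • contract h' ((𝒜.differential q' ξ).at x) (Λ.1 x)) = _
  rw [𝒜.differential_at_of_eventuallyEq_smul hξη, contract_add_left, contract_smul_left,
    contract_domDomCongr]
  congr 3
  · exact (map_smul _ _ _).symm
  · rw [← sum_smul_wedge_coord b, ← contractRight_apply, map_sum]
    refine Finset.sum_congr rfl fun i _ => ?_
    rw [hnabla, map_smul, map_smul]
    rfl

theorem existsUnique_isGeneratingOperator {n : ℕ} (hn : Module.finrank ℝ F = n)
    (nabla : 𝒜.Connection n) (Λ : Multivector I F V n) (hΛ : ∀ x, Λ.1 x ≠ 0)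
    (hhor : ∀ X, nabla.toFun X Λ = 0) (k : ℕ) : ∃! D, IsGeneratingOperator nabla k D := by
  by_cases hk : k + 1 ≤ n
  · have h : (n - (k + 1)) + (k + 1) = n := by omega
    refine ⟨_, isGeneratingOperator_star hn nabla Λ hΛ hhor (n - (k + 1)) k h (by omega),
      fun D hD => ?_⟩
    have hD' := isGeneratingOperator_star hn nabla Λ hΛ hhor (n - (k + 1)) k h (by omega)
    refine LinearMap.ext fun U => Subtype.ext (funext fun x => ?_)
    have := VectorBundle.finiteDimensional ℝ F V x
    let b := Module.finBasisOfFinrankEq ℝ (V x) (finrank_fibre hn x)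
    let η := (starEquiv hn Λ hΛ (n - (k + 1)) (k + 1) h).symm U
    have hη : ∀ᶠ y in 𝓝 x, U.1 y = contract h (η.at y) (Λ.1 y) := .of_forall fun y => by
      rw [← starEquiv_apply hn Λ hΛ _ (k + 1) h, LinearEquiv.apply_symm_apply]
    rw [hD _ h U η Λ x (hΛ x) hη (fun i => extendSection I F x (b i)) b (by simp),
      hD' _ h U η Λ x (hΛ x) hη (fun i => extendSection I F x (b i)) b (by simp)]
  · -- above degree `n` the source is zero and the defining condition is empty
    have := subsingleton_multivector (I := I) (V := V) hn (show n < k + 1 by omega)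
    exact ⟨0, fun q h => by omega, fun D _ => LinearMap.ext fun U => by
      rw [Subsingleton.elim U 0, map_zero, map_zero]⟩

theorem boundary_eq {n : ℕ} (hn : Module.finrank ℝ F = n)
    (nabla : 𝒜.Connection n) (Λ : Multivector I F V n) (hΛ : ∀ x, Λ.1 x ≠ 0)
    (hhor : ∀ X, nabla.toFun X Λ = 0) (q k : ℕ) (h : q + (k + 1) = n) (h' : q + 1 + k = n) :
    boundary nabla k = -((starEquiv hn Λ hΛ (q + 1) k h').toLinearMap ∘ₗ 𝒜.differential q ∘ₗ
      (starEquiv hn Λ hΛ q (k + 1) h).symm.toLinearMap) := by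
  have hu := existsUnique_isGeneratingOperator hn nabla Λ hΛ hhor k
  have hg : generatingOperator nabla k =
      -((-1 : ℝ) ^ q • ((starEquiv hn Λ hΛ (q + 1) k h').toLinearMap ∘ₗ 𝒜.differential q ∘ₗ
        (starEquiv hn Λ hΛ q (k + 1) h).symm.toLinearMap)) := by
    rw [generatingOperator, dif_pos hu.exists]
    exact hu.unique hu.exists.choose_spec
      (isGeneratingOperator_star hn nabla Λ hΛ hhor q k h h')
  have hz : (n : ℤ) - ((k : ℤ) + 1) = (q : ℤ) := by omega
  rw [boundary, hg, hz, zpow_natCast, smul_neg, smul_smul, ← mul_pow]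
  norm_num

theorem map_star_cocycles {n : ℕ} (hn : Module.finrank ℝ F = n)
    (nabla : 𝒜.Connection n) (Λ : Multivector I F V n) (hΛ : ∀ x, Λ.1 x ≠ 0)
    (hhor : ∀ X, nabla.toFun X Λ = 0) (q k : ℕ) (h : q + k = n) :
    (𝒜.cocycles q).map (starEquiv hn Λ hΛ q k h).toLinearMap = cycles nabla k := by
  cases k with
  | zero =>
    -- in degree `n` every form is closed, and in degree `0` every multivector is a cycle
    have := subsingleton_form (I := I) (V := V) hn (show n < q + 1 by omega)
    have htop : 𝒜.cocycles q = ⊤ := eq_top_iff.2 fun η _ => Subsingleton.elim _ _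
    rw [htop, Submodule.map_top, LinearEquiv.range]
    rfl
  | succ k =>
    ext U
    rw [cycles, LinearMap.mem_ker, boundary_eq hn nabla Λ hΛ hhor q k h (by omega),
      LinearMap.neg_apply, neg_eq_zero, LinearMap.comp_apply, LinearEquiv.coe_coe,
      LinearEquiv.map_eq_zero_iff, Submodule.mem_map_equiv]
    rfl

theorem map_star_coboundaries {n : ℕ} (hn : Module.finrank ℝ F = n)
    (nabla : 𝒜.Connection n) (Λ : Multivector I F V n) (hΛ : ∀ x, Λ.1 x ≠ 0)
    (hhor : ∀ X, nabla.toFun X Λ = 0) (q k : ℕ) (h : q + k = n) :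
    (𝒜.coboundaries q).map (starEquiv hn Λ hΛ q k h).toLinearMap = boundaries nabla k := by
  cases q with
  | zero =>
    -- no nonzero form of degree `0` is exact, and `∂` starts from `Γ(∧ⁿ⁺¹A) = 0`
    have := subsingleton_multivector (I := I) (V := V) hn (show n < k + 1 by omega)
    rw [coboundaries, Submodule.map_bot, boundaries, eq_comm, LinearMap.range_eq_bot]
    exact LinearMap.ext fun U => by rw [Subsingleton.elim U 0, map_zero, map_zero]
  | succ q =>
    rw [boundaries, boundary_eq hn nabla Λ hΛ hhor q k (by omega) h, LinearMap.range_neg,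
      LinearMap.range_comp, LinearMap.range_comp_of_range_eq_top _ (LinearEquiv.range _)]
    rfl

end LieAlgebroid
end Generating

end LieAlgebroidHomology

end

theorem mainTheorem4 {m n : ℕ}
    {M : Type*} [TopologicalSpace M] [T2Space M] [SecondCountableTopology M]
    [ChartedSpace (EuclideanSpace ℝ (Fin m)) M] [IsManifold (𝓡 m) ∞ M]
    {F : Type*} [NormedAddCommGroup F] [NormedSpace ℝ F] [FiniteDimensional ℝ F]
    (hn : Module.finrank ℝ F = n)
    {V : M → Type*} [TopologicalSpace (TotalSpace F V)]
    [∀ x, AddCommGroup (V x)] [∀ x, Module ℝ (V x)] [∀ x, TopologicalSpace (V x)]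
    [FiberBundle F V] [VectorBundle ℝ F V] [ContMDiffVectorBundle ∞ F V (𝓡 m)]
    (𝒜 : LieAlgebroid (𝓡 m) F V) (nabla : 𝒜.Connection n)
    (Λ : Multivector (𝓡 m) F V n) (hΛ : ∀ x, Λ.1 x ≠ 0)
    (hhor : ∀ X, nabla.toFun X Λ = 0) :
    (∀ k, ∃! d, 𝒜.IsDifferential k d) ∧
    (∀ k, ∃! D, LieAlgebroid.IsGeneratingOperator nabla k D) ∧
    ∃ star : ∀ q k : ℕ, q + k = n → (Form (𝓡 m) F V q ≃ₗ[ℝ] Multivector (𝓡 m) F V k),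
      (∀ q k (h : q + k = n) η x,
        (star q k h η).1 x = contract h (η.at x) (Λ.1 x)) ∧
      (∀ q k (h : q + (k + 1) = n),
        LieAlgebroid.boundary nabla k =
          -((star (q + 1) k (by omega)).toLinearMap ∘ₗ 𝒜.differential q ∘ₗ
            (star q (k + 1) h).symm.toLinearMap)) ∧
      (∀ q k (h : q + k = n),
        ∃ Φ : 𝒜.Cohomology q ≃ₗ[ℝ] LieAlgebroid.Homology nabla k,
          ∀ η : 𝒜.cocycles q, ∃ hU : star q k h η ∈ LieAlgebroid.cycles nabla k,
            Φ (Submodule.Quotient.mk η) = Submodule.Quotient.mk ⟨star q k h η, hU⟩) := by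
  refine ⟨𝒜.existsUnique_isDifferential,
    LieAlgebroid.existsUnique_isGeneratingOperator hn nabla Λ hΛ hhor, starEquiv hn Λ hΛ,
    starEquiv_apply hn Λ hΛ, fun q k h => LieAlgebroid.boundary_eq hn nabla Λ hΛ hhor q k h _,
    fun q k h => ?_⟩
  have hcyc := LieAlgebroid.map_star_cocycles hn nabla Λ hΛ hhor q k h
  have hbd := LieAlgebroid.map_star_coboundaries hn nabla Λ hΛ hhor q k h
  let e : 𝒜.cocycles q ≃ₗ[ℝ] LieAlgebroid.cycles nabla k :=
    (starEquiv hn Λ hΛ q k h).ofSubmodules _ _ hcyc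
  refine ⟨Submodule.Quotient.equiv _ _ e ?_, fun η => ⟨(e η).2, rfl⟩⟩
  ext U
  rw [Submodule.mem_map_equiv, Submodule.mem_comap, Submodule.mem_comap, ← hbd,
    Submodule.mem_map_equiv]
  rfl
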